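/- Let $p,d,n$ be integers with $1\le d\le p-1$ and $n\ge 0$, and let $\lambda>0$ and $\omega\ge 1$ be reals with $\omega\ge\lambda d$. For a real vector $\theta=(\theta_{st})$ indexed by the unordered pairs of distinct elements of $V=\{1,\dots,p\}$, the Ising model $\mathbb P_\theta$ is the distribution on $\{-1,+1\}^p$ with $$\mathbb P_\theta(x)=\frac1{Z(\theta)}\exp\Big\{\sum_{\{s,t\}}\theta_{st}x_sx_t\Big\},\qquad Z(\theta)=\sum_{y\in\{-1,+1\}^p}\exp\Big\{\sum_{\{s,t\}}\theta_{st}y_sy_t\Big\}.$$ Let $\mathcal G_{p,d}$ be the set of simple graphs on $V$ in which every vertex has degree at most $d$. A weight vector $\theta$ is called admissible for $G=(V,E)\in\mathcal G_{p,d}$ if $\theta_{st}=0$ for $\{s,t\}\notin E$, $|\theta_{st}|\ge\lambda$ for $\{s,t\}\in E$, and $\sum_{t:\{s,t\}\in E}|\theta_{st}|\le\omega$ for every $s\in V$. The class $\mathcal G_{p,d}(\lambda,\omega)$ consists of the models $\mathbb P_{\theta}$ with $\theta$ admissible for some $G\in\mathcal G_{p,d}$. A graph decoder is a function $\phi:(\{-1,+1\}^p)^n\to\mathcal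 G_{p,d}$, and $\mathbb P_\theta[\phi(X_1^n)\ne G]$ denotes its probability of error when $X_1^n$ consists of $n$ independent samples from $\mathbb P_\theta$. Put $$A=\frac{\log p}{2\lambda\tanh\lambda},\qquad B=\frac{\exp(\omega/4)\,d\lambda\,\log\left(\frac{pd}4-1\right)}{128\exp(3\lambda/2)},\qquad C=\frac d8\log\frac p{8d},$$ where $B$ is omitted from every maximum if $pd\le 4$. Suppose that $n\le\max\{A,B,C\}$. In the degenerate case $d=1$ suppose moreover that either $\omega=\lambda$, or $p\ge3$ and $n\le\max\{A,C\}$. Then: 1. (Known edge weights.) There is an assignment $G\mapsto\theta(G)$ of an admissible weight vector to every $G\in\mathcal G_{p,d}$ such that every graph decoder $\phi$ (which may depend on this assignment) satisfies $$\max_{G\in\mathcal G_{p,d}}\mathbb P_{\theta(G)}\big[\phi(X_1^n)\ne G\big]\ge\tfrac12.$$ 2. (Unknown edge weights.) For every graph decoder $\phi$ there are $G\in\mathcal G_{p,d}$ and a weight vector $\theta$ admissible for $G$ with $\mathbb P_\theta[\phi(X_1^n)\ne G]\ge\frac12$. -/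

import Mathlib

namespace IsingSelection

noncomputable section

/-- Spin configurations: `ℤˣ = {1, -1}`. -/
abbrev Config (p : ℕ) := Fin p → ℤˣ

/-- A vector of real weights, one for each unordered pair of vertices. The diagonal pairs are
never used. -/
abbrev Weights (p : ℕ) := Sym2 (Fin p) → ℝ

/-- The exponent `∑ θ_{st} x_s x_t`, each unordered pair `s ≠ t` being counted once. When `θ`
vanishes off the edge set of a graph this is the sum over the edges of that graph. -/
def energy {p : ℕ} (θ : Weights p) (x : Config p) : ℝ :=
  ∑ s : Fin p, ∑ t ∈ Finset.Ioi s, θ s(s, t) * ((x s : ℤ) : ℝ) * ((x t : ℤ) : ℝ)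

/-- The normalization factor. -/
def partitionFn {p : ℕ} (θ : Weights p) : ℝ :=
  ∑ x : Config p, Real.exp (energy θ x)

/-- The probability mass function of the Ising model with weights `θ`. -/
def isingPMF {p : ℕ} (θ : Weights p) (x : Config p) : ℝ :=
  Real.exp (energy θ x) / partitionFn θ

open Classical in
/-- Graphs on `p` vertices all of whose degrees are at most `d`. -/
def BoundedDegreeGraph (p d : ℕ) : Type :=
  {G : SimpleGraph (Fin p) // ∀ v, G.degree v ≤ d}

open Classical in
/-- The weights `θ` respect the graph `G`, every edge weight is at least `lam` in absolute value,
and every neighborhood weight is at most `ω`. -/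
structure Admissible {p : ℕ} (lam ω : ℝ) (G : SimpleGraph (Fin p)) (θ : Weights p) : Prop where
  support : ∀ e : Sym2 (Fin p), θ e ≠ 0 → e ∈ G.edgeSet
  min_weight : ∀ e ∈ G.edgeSet, lam ≤ |θ e|
  nbhd_weight : ∀ s : Fin p, ∑ t ∈ G.neighborFinset s, |θ s(s, t)| ≤ ω

/-- A graph decoder: a function of `n` samples with values in the graphs of degree at most `d`. -/
abbrev Decoder (p d n : ℕ) := (Fin n → Config p) → BoundedDegreeGraph p d

open Classical in
/-- The probability that the decoder `φ` does not return `G` when its input consists of `n`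
independent samples from the Ising model with weights `θ`. -/
def errorProb {p d n : ℕ} (φ : Decoder p d n) (G : BoundedDegreeGraph p d) (θ : Weights p) : ℝ :=
  ∑ X : Fin n → Config p, if φ X ≠ G then ∏ i, isingPMF θ (X i) else 0

/-- First threshold on the sample size. -/
def boundA (p : ℕ) (lam : ℝ) : ℝ :=
  Real.log p / (2 * lam * Real.tanh lam)

/-- Second threshold on the sample size. (If `p * d ≤ 4`, where the logarithm is negative
or undefined, this value is nonpositive.) -/
def boundB (p d : ℕ) (lam ω : ℝ) : ℝ :=
  Real.exp (ω / 4) * d * lam * Real.log ((p : ℝ) * d / 4 - 1) / (128 * Real.exp (3 * lam / 2))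

/-- Third threshold on the sample size. -/
def boundC (p d : ℕ) : ℝ :=
  (d : ℝ) / 8 * Real.log ((p : ℝ) / (8 * d))

end

end IsingSelection

namespace IsingSelection

/-! ### The exponential family -/

/-! If a decoder errs with probability below 1/2 on every graph, each model gives its own decoding
region mass above 1/2, while the regions are disjoint. For each threshold there is a family of
graphs for which this is impossible; graphs outside it get default weights by
`exists_admissible_extension`. Unknown weights are then no easier, since the same weights serve as
the hard instance.

For `boundA` the family is the empty graph and all one-edge graphs. By
`exists_half_le_errorProb_of_chiSq`, m alternatives with chi-square divergence at most K - 1 from a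
reference cannot be recognised while K ^ n ≤ m² / (2m - 1); a single edge of weight λ costs only
tanh² λ.

For `boundB`, strong interactions hide an edge. In a path with both weights ω/2 the end spins have
correlation tanh² (ω/2), so closing the triangle costs divergence at most 8 exp(-ω), and there are p
/ 3 disjoint paths to close. For p ≤ 5 the three paths on three fixed vertices are compared instead:
up to probability 2 exp(-ω) the three spins agree, and on that event the models have a common
majorant (`exists_half_le_errorProb_of_common_part`).

For `boundC` it is enough to count: n samples take only 2 ^ (n p) values, while unions of perfect
matchings between blocks give (k!) ^ (d²) graphs, whatever the weights.

Paths need d ≥ 2. For d = 1 and ω = λ, `boundB` is so small that one-edge graphs suffice. -/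

theorem spin_mul_self (u : ℤˣ) : ((u : ℤ) : ℝ) * ((u : ℤ) : ℝ) = 1 := by
  rcases Int.units_eq_one_or u with rfl | rfl <;> simp

theorem energy_add {p : ℕ} (θ θ' : Weights p) (x : Config p) :
    energy (θ + θ') x = energy θ x + energy θ' x := by
  simp only [energy, Pi.add_apply, add_mul, Finset.sum_add_distrib]

theorem energy_single {p : ℕ} {a b : Fin p} (hab : a ≠ b) (c : ℝ) (x : Config p) :
    energy (Pi.single s(a, b) c) x = c * (((x a : ℤ) : ℝ) * ((x b : ℤ) : ℝ)) := by
  wlog h : a < b generalizing a b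
  · rw [Sym2.eq_swap, this hab.symm (lt_of_le_of_ne (not_lt.1 h) hab.symm)]
    ring
  unfold energy
  rw [Finset.sum_eq_single a, Finset.sum_eq_single b]
  · simp [mul_assoc]
  · intro t _ ht
    rw [Pi.single_eq_of_ne]
    · simp
    · simp [ht, hab]
  · intro hb
    simp [h] at hb
  · intro s _ hs
    refine Finset.sum_eq_zero fun t ht => ?_
    rw [Pi.single_eq_of_ne]
    · simp
    · intro h'
      rcases Sym2.eq_iff.1 h' with h' | h'
      · exact hs h'.1
      · rw [h'.1, h'.2] at ht
        exact absurd (Finset.mem_Ioi.1 ht) (not_lt.2 h.le)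
  · simp

theorem energy_update {p : ℕ} {θ : Weights p} {s : Fin p} (h : ∀ u, θ s(s, u) = 0)
    (x : Config p) (v : ℤˣ) : energy θ (Function.update x s v) = energy θ x := by
  unfold energy
  refine Finset.sum_congr rfl fun a _ => Finset.sum_congr rfl fun b _ => ?_
  by_cases ha : a = s
  · subst ha; simp [h]
  by_cases hb : b = s
  · subst hb; simp [Sym2.eq_swap (a := a), h]
  simp [Function.update_of_ne, ha, hb]

theorem partitionFn_pos {p : ℕ} (θ : Weights p) : 0 < partitionFn θ :=
  Finset.sum_pos (fun _ _ => Real.exp_pos _) Finset.univ_nonempty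

theorem isingPMF_pos {p : ℕ} (θ : Weights p) (x : Config p) : 0 < isingPMF θ x :=
  div_pos (Real.exp_pos _) (partitionFn_pos θ)

theorem sum_isingPMF {p : ℕ} (θ : Weights p) : ∑ x, isingPMF θ x = 1 := by
  simp only [isingPMF, ← Finset.sum_div]
  exact div_self (partitionFn_pos θ).ne'

/-- Negating a single spin. -/
def flipAt {p : ℕ} (s : Fin p) : Equiv.Perm (Config p) :=
  Function.Involutive.toPerm (fun x => Function.update x s (-x s)) fun x => by simp

theorem flipAt_same {p : ℕ} (s : Fin p) (x : Config p) : flipAt s x s = -x s := by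
  simp [flipAt, Function.Involutive.toPerm]

theorem flipAt_of_ne {p : ℕ} {s t : Fin p} (h : t ≠ s) (x : Config p) : flipAt s x t = x t := by
  simp [flipAt, Function.Involutive.toPerm, h]

theorem energy_flipAt {p : ℕ} {θ : Weights p} {s : Fin p} (h : ∀ u, θ s(s, u) = 0)
    (x : Config p) : energy θ (flipAt s x) = energy θ x :=
  energy_update h x _

/-- If `s` interacts only with `h`, then a spin at `s` can be replaced in expectations by
`tanh w` times the spin at `h`. -/
theorem sum_exp_energy_mul_leaf {p : ℕ} {θ : Weights p} {s h : Fin p} {w : ℝ} (hsh : s ≠ h)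
    (hθ : θ s(s, h) = w) (hleaf : ∀ u, u ≠ h → θ s(s, u) = 0) {F : Config p → ℝ}
    (hF : ∀ x, F (flipAt s x) = F x) :
    ∑ x, Real.exp (energy θ x) * (((x s : ℤ) : ℝ) * F x) =
      Real.tanh w * ∑ x, Real.exp (energy θ x) * (((x h : ℤ) : ℝ) * F x) := by
  set θ' : Weights p := Function.update θ s(s, h) 0 with hθ'
  have hdec : θ = θ' + Pi.single s(s, h) w := by
    ext e
    by_cases he : e = s(s, h)
    · subst he; simp [hθ', hθ]
    · simp [hθ', he]
  have h0 : ∀ u, θ' s(s, u) = 0 := by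
    intro u
    by_cases hu : u = h
    · subst hu; simp [hθ']
    · rw [hθ', Function.update_of_ne, hleaf u hu]
      simp [hu, hsh]
  have hE : ∀ x, energy θ x = energy θ' x + w * (((x s : ℤ) : ℝ) * ((x h : ℤ) : ℝ)) := by
    intro x
    rw [hdec, energy_add, energy_single hsh]
  have symm : ∀ f : Config p → ℝ, ∑ x, f x = ∑ x, (f x + f (flipAt s x)) / 2 := by
    intro f
    rw [← Finset.sum_div, Finset.sum_add_distrib, Equiv.sum_comp (flipAt s) f]
    ring
  rw [symm, symm fun x => _ * _, Finset.mul_sum]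
  refine Finset.sum_congr rfl fun x _ => ?_
  have hE' : energy θ (flipAt s x) =
      energy θ' x - w * (((x s : ℤ) : ℝ) * ((x h : ℤ) : ℝ)) := by
    rw [hE, energy_flipAt h0, flipAt_same, flipAt_of_ne hsh.symm]
    push_cast
    ring
  -- Averaged over the flip at `s`, the two sides carry the factors sinh w and tanh w * cosh w.
  rw [hE', hE, hF, flipAt_same, flipAt_of_ne hsh.symm, Real.tanh_eq_sinh_div_cosh]
  have hc := (Real.cosh_pos w).ne'
  rw [Real.sinh_eq, Real.cosh_eq] at *
  have e1 : 0 < Real.exp w + Real.exp (-w) := by positivity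
  rcases Int.units_eq_one_or (x s) with h1 | h1 <;> rcases Int.units_eq_one_or (x h) with h2 | h2 <;>
    simp only [h1, h2, Real.exp_add, Real.exp_sub, Units.val_one, Units.val_neg, Int.cast_one,
      Int.cast_neg, mul_one, mul_neg, neg_neg, sub_neg_eq_add, Real.exp_neg] <;>
    field_simp <;> ring

theorem exp_mul_spin_mul_spin (l : ℝ) (u v : ℤˣ) :
    Real.exp (l * (((u : ℤ) : ℝ) * ((v : ℤ) : ℝ))) =
      Real.cosh l + (((u : ℤ) : ℝ) * ((v : ℤ) : ℝ)) * Real.sinh l := by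
  rw [Real.cosh_eq, Real.sinh_eq]
  rcases Int.units_eq_one_or u with rfl | rfl <;> rcases Int.units_eq_one_or v with rfl | rfl <;>
    simp <;> ring

/-- The chi-square divergence caused by one additional edge between nonnegatively correlated
spins. -/
theorem sum_sq_isingPMF_add_single_div_le {p : ℕ} (θ : Weights p) {a b : Fin p} (hab : a ≠ b)
    {l μ : ℝ} (hl : 0 ≤ l) (hμ : 0 ≤ μ)
    (hcorr : ∑ x, Real.exp (energy θ x) * (((x a : ℤ) : ℝ) * ((x b : ℤ) : ℝ)) =
      μ * partitionFn θ) :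
    ∑ x, isingPMF (θ + Pi.single s(a, b) l) x ^ 2 / isingPMF θ x ≤
      1 + Real.tanh l ^ 2 * (1 - μ ^ 2) := by
  have hμ1 : μ ≤ 1 := by
    have hZ := partitionFn_pos θ
    refine le_of_mul_le_mul_right ?_ hZ
    rw [← hcorr, one_mul]
    refine Finset.sum_le_sum fun x _ => mul_le_of_le_one_right (Real.exp_pos _).le ?_
    rcases Int.units_eq_one_or (x a) with h1 | h1 <;>
      rcases Int.units_eq_one_or (x b) with h2 | h2 <;> simp [h1, h2]
  have key : ∀ l : ℝ, ∑ x : Config p, Real.exp (energy θ x) *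
      Real.exp (l * (((x a : ℤ) : ℝ) * ((x b : ℤ) : ℝ))) =
      (Real.cosh l + μ * Real.sinh l) * partitionFn θ := by
    intro l
    simp only [exp_mul_spin_mul_spin, mul_add, Finset.sum_add_distrib]
    rw [add_mul, mul_right_comm μ, ← hcorr]
    simp only [partitionFn, mul_comm (Real.cosh l), Finset.sum_mul, mul_assoc]
  have hZ' : partitionFn (θ + Pi.single s(a, b) l) =
      (Real.cosh l + μ * Real.sinh l) * partitionFn θ := by
    rw [← key]
    simp only [partitionFn, energy_add, energy_single hab, Real.exp_add]
  have hs : 0 ≤ Real.sinh l := Real.sinh_nonneg_iff.2 hl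
  have hc := Real.cosh_pos l
  have hD : 0 < Real.cosh l + μ * Real.sinh l := by positivity
  have hZ := partitionFn_pos θ
  have : ∑ x, isingPMF (θ + Pi.single s(a, b) l) x ^ 2 / isingPMF θ x =
      (Real.cosh (2 * l) + μ * Real.sinh (2 * l)) / (Real.cosh l + μ * Real.sinh l) ^ 2 := by
    have : ∀ x, isingPMF (θ + Pi.single s(a, b) l) x ^ 2 / isingPMF θ x =
        Real.exp (energy θ x) * Real.exp (2 * l * (((x a : ℤ) : ℝ) * ((x b : ℤ) : ℝ))) *
        (1 / ((Real.cosh l + μ * Real.sinh l) ^ 2 * partitionFn θ)) := by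
      intro x
      rw [isingPMF, isingPMF, hZ', energy_add, energy_single hab, Real.exp_add, mul_assoc 2,
        two_mul, Real.exp_add]
      have := (Real.exp_pos (energy θ x)).ne'
      field_simp
    rw [Finset.sum_congr rfl fun x _ => this x, ← Finset.sum_mul, key]
    field_simp
  rw [this, Real.cosh_two_mul, Real.sinh_two_mul, Real.tanh_eq_sinh_div_cosh]
  have h1 : 0 ≤ 1 - μ ^ 2 := by nlinarith
  -- The numerator exceeds (cosh l + μ sinh l)² by sinh² l (1 - μ²). As μ sinh l ≥ 0, the
  -- denominator may then be lowered to cosh² l.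
  have h2 : (Real.cosh l ^ 2 + Real.sinh l ^ 2 + μ * (2 * Real.sinh l * Real.cosh l)) /
      (Real.cosh l + μ * Real.sinh l) ^ 2 =
      1 + Real.sinh l ^ 2 * (1 - μ ^ 2) / (Real.cosh l + μ * Real.sinh l) ^ 2 := by
    field_simp
    ring
  rw [h2, div_pow, div_mul_eq_mul_div]
  gcongr
  exact le_add_of_nonneg_right (by positivity)

/-! ### Testing bounds -/

/-- The probability that the decoder returns `G`. -/
noncomputable def outputProb {p d n : ℕ} (φ : Decoder p d n) (θ : Weights p)
    (G : BoundedDegreeGraph p d) : ℝ :=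
  open Classical in ∑ X with φ X = G, ∏ i, isingPMF θ (X i)

theorem prod_isingPMF_nonneg {p n : ℕ} (θ : Weights p) (X : Fin n → Config p) :
    0 ≤ ∏ i, isingPMF θ (X i) :=
  Finset.prod_nonneg fun _ _ => (isingPMF_pos θ _).le

theorem sum_prod_isingPMF {p : ℕ} (n : ℕ) (θ : Weights p) :
    ∑ X : Fin n → Config p, ∏ i, isingPMF θ (X i) = 1 := by
  rw [← Fintype.sum_pow, sum_isingPMF, one_pow]

theorem outputProb_add_errorProb {p d n : ℕ} (φ : Decoder p d n) (G : BoundedDegreeGraph p d)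
    (θ : Weights p) : outputProb φ θ G + errorProb φ G θ = 1 := by
  classical
  rw [outputProb, errorProb, ← sum_prod_isingPMF n θ, ← Finset.sum_filter]
  convert Finset.sum_filter_add_sum_filter_not Finset.univ (fun X => φ X = G)
    (fun X => ∏ i, isingPMF θ (X i)) using 2

open Classical in
/-- Total mass assigned by a nonnegative weight to disjoint decoding regions. -/
theorem sum_sum_filter_decoder_le {p d n : ℕ} {ι : Type*} [Fintype ι] (φ : Decoder p d n)
    {G : ι → BoundedDegreeGraph p d} (hG : Function.Injective G)
    {f : (Fin n → Config p) → ℝ} (hf : ∀ X, 0 ≤ f X) :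
    ∑ i, ∑ X with φ X = G i, f X ≤ ∑ X, f X := by
  simp only [Finset.sum_filter]
  rw [Finset.sum_comm]
  refine Finset.sum_le_sum fun X _ => ?_
  rw [← Finset.sum_filter, Finset.sum_const, nsmul_eq_mul]
  refine mul_le_of_le_one_left (hf X) ?_
  exact_mod_cast Finset.card_le_one.2 fun a ha b hb => hG <| by
    rw [← (Finset.mem_filter.1 ha).2, ← (Finset.mem_filter.1 hb).2]

theorem sum_outputProb_le_one {p d n : ℕ} {ι : Type*} [Fintype ι] (φ : Decoder p d n)
    (θ : Weights p) {G : ι → BoundedDegreeGraph p d} (hG : Function.Injective G) :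
    ∑ i, outputProb φ θ (G i) ≤ 1 :=
  (sum_sum_filter_decoder_le φ hG fun _ => prod_isingPMF_nonneg θ _).trans_eq
    (sum_prod_isingPMF n θ)

/-- Data processing for the chi-square divergence, on a two-block partition. -/
theorem sq_div_add_sq_div_le_sum_sq_div {Ω : Type*} [Fintype Ω] [DecidableEq Ω] {f g : Ω → ℝ}
    (hg : ∀ x, 0 < g x) (s : Finset Ω) :
    (∑ x ∈ s, f x) ^ 2 / (∑ x ∈ s, g x) + (∑ x ∈ sᶜ, f x) ^ 2 / (∑ x ∈ sᶜ, g x) ≤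
      ∑ x, f x ^ 2 / g x := by
  rw [← Finset.sum_add_sum_compl s]
  exact add_le_add (Finset.sq_sum_div_le_sum_sq_div s f fun x _ => hg x)
    (Finset.sq_sum_div_le_sum_sq_div sᶜ f fun x _ => hg x)

/-- The right side is 1 + (a - r)² / (r (1 - r)), which increases in a beyond r. At a = 1/2 it is 1
/ (4 r (1 - r)), decreasing for r < 1/2 and equal to the left side at r = 1 / (2m). -/
theorem sq_div_sub_one_lt_of_lt {m a r : ℝ} (hm : 1 ≤ m) (ha : 1 / 2 < a) (hr0 : 0 < r)
    (hr : r < 1 / (2 * m)) : m ^ 2 / (2 * m - 1) < a ^ 2 / r + (1 - a) ^ 2 / (1 - r) := by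
  have hm0 : 0 < m := by linarith
  have hrm : r * (2 * m) < 1 := (lt_div_iff₀ (by positivity)).1 hr
  have hr2 : r < 1 / 2 := by nlinarith
  have h1 : a ^ 2 / r + (1 - a) ^ 2 / (1 - r) = 1 + (a - r) ^ 2 / (r * (1 - r)) := by
    have : 1 - r ≠ 0 := by linarith
    field_simp
    ring
  have hrr : 0 < r * (1 - r) := mul_pos hr0 (by linarith)
  have h2 : m ^ 2 / (2 * m - 1) ≤ 1 + (1 / 2 - r) ^ 2 / (r * (1 - r)) := by
    have : 1 + (1 / 2 - r) ^ 2 / (r * (1 - r)) = 1 / (4 * (r * (1 - r))) := by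
      have : 1 - r ≠ 0 := by linarith
      field_simp
      ring
    rw [this, div_le_div_iff₀ (by linarith) (by positivity)]
    nlinarith [mul_nonneg (sub_nonneg.2 hrm.le) (sub_nonneg.2 hr2.le),
      mul_nonneg hm0.le (sub_nonneg.2 hrm.le), mul_pos hr0 hm0,
      mul_nonneg (mul_nonneg hm0.le (sub_nonneg.2 hrm.le)) (sub_nonneg.2 hr2.le)]
  rw [h1]
  refine h2.trans_lt ?_
  have : (1 / 2 - r) ^ 2 < (a - r) ^ 2 := by nlinarith
  gcongr

open Classical in
/-- If each of `m` alternatives has chi-square divergence at most `K - 1` from a common reference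
model, then some graph is decoded incorrectly with probability at least `1 / 2`. -/
theorem exists_half_le_errorProb_of_chiSq {p d n : ℕ} {ι : Type*} [Fintype ι] [Nonempty ι]
    {θ : BoundedDegreeGraph p d → Weights p} {G : Option ι → BoundedDegreeGraph p d}
    (hG : Function.Injective G) {K : ℝ}
    (hK : ∀ i, ∑ x, isingPMF (θ (G (some i))) x ^ 2 / isingPMF (θ (G none)) x ≤ K)
    (hKn : K ^ n ≤ (Fintype.card ι : ℝ) ^ 2 / (2 * Fintype.card ι - 1)) (φ : Decoder p d n) :
    ∃ H, 1 / 2 ≤ errorProb φ H (θ H) := by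
  by_contra! hcon
  have hout : ∀ H, 1 / 2 < outputProb φ (θ H) H := fun H => by
    linarith [hcon H, outputProb_add_errorProb φ H (θ H)]
  have hm1 : (1 : ℝ) ≤ Fintype.card ι := by exact_mod_cast Fintype.card_pos
  have hm0 : (0 : ℝ) < Fintype.card ι := by linarith
  -- The reference model spends more than 1/2 on its own region, so the m others share less than
  -- 1/2.
  obtain ⟨i, hi⟩ : ∃ i, outputProb φ (θ (G none)) (G (some i)) < 1 / (2 * Fintype.card ι) := by
    by_contra! h
    have h1 := sum_outputProb_le_one φ (θ (G none)) hG
    rw [Fintype.sum_option] at h1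
    have h2 := Finset.sum_le_sum fun i (_ : i ∈ Finset.univ) => h i
    rw [Finset.sum_const, nsmul_eq_mul, Finset.card_univ] at h2
    have h3 : (Fintype.card ι : ℝ) * (1 / (2 * Fintype.card ι)) = 1 / 2 := by field_simp
    linarith [hout (G none)]
  set P := fun X : Fin n → Config p => ∏ j, isingPMF (θ (G (some i))) (X j)
  set Q := fun X : Fin n → Config p => ∏ j, isingPMF (θ (G none)) (X j)
  set s : Finset (Fin n → Config p) := {X | φ X = G (some i)}
  have hQ : ∀ X, 0 < Q X := fun X => Finset.prod_pos fun _ _ => isingPMF_pos _ _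
  have hchi : ∑ X, P X ^ 2 / Q X ≤ K ^ n := by
    simp only [P, Q, ← Finset.prod_pow, ← Finset.prod_div_distrib]
    rw [← Fintype.sum_pow fun x => isingPMF (θ (G (some i))) x ^ 2 / isingPMF (θ (G none)) x]
    exact pow_le_pow_left₀ (Finset.sum_nonneg fun x _ =>
      div_nonneg (sq_nonneg _) (isingPMF_pos _ _).le) (hK i) n
  have hcompl : ∀ f : (Fin n → Config p) → ℝ, ∑ X, f X = 1 →
      ∑ X ∈ sᶜ, f X = 1 - ∑ X ∈ s, f X := fun f hf => by
    rw [← hf, ← Finset.sum_add_sum_compl s]; ring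
  have ha : 1 / 2 < ∑ X ∈ s, P X := hout (G (some i))
  have hr : ∑ X ∈ s, Q X < 1 / (2 * Fintype.card ι) := hi
  have hr0 : 0 < ∑ X ∈ s, Q X := by
    refine Finset.sum_pos (fun X _ => hQ X) (Finset.nonempty_iff_ne_empty.2 fun h => ?_)
    rw [h, Finset.sum_empty] at ha
    linarith
  have h1 := sq_div_add_sq_div_le_sum_sq_div (f := P) hQ s
  rw [hcompl P (sum_prod_isingPMF n _), hcompl Q (sum_prod_isingPMF n _)] at h1
  linarith [sq_div_sub_one_lt_of_lt hm1 ha hr0 hr]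

/-- If finitely many models share a dominating sub-probability `Q` up to mass `η` each, then some
graph is decoded incorrectly with probability at least `1 / 2`. -/
theorem exists_half_le_errorProb_of_common_part {p d n : ℕ} {ι : Type*} [Fintype ι] [Nonempty ι]
    {θ : BoundedDegreeGraph p d → Weights p} {G : ι → BoundedDegreeGraph p d}
    (hG : Function.Injective G) {η : ℝ} {f : ι → Config p → ℝ} {Q : Config p → ℝ}
    (hQ : ∑ x, Q x ≤ 1) (hf : ∀ i x, 0 ≤ f i x) (hfQ : ∀ i x, f i x ≤ Q x)
    (hfP : ∀ i x, f i x ≤ isingPMF (θ (G i)) x) (hη : ∀ i, 1 - η ≤ ∑ x, f i x) (hη1 : η ≤ 1)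
    (hn : 1 + Fintype.card ι * (n * η) ≤ (Fintype.card ι : ℝ) / 2) (φ : Decoder p d n) :
    ∃ H, 1 / 2 ≤ errorProb φ H (θ H) := by
  classical
  by_contra! hcon
  have hQ0 : ∀ x, 0 ≤ Q x := fun x => (hf (Classical.arbitrary ι) x).trans (hfQ _ x)
  have hout : ∀ i, outputProb φ (θ (G i)) (G i) ≤
      (∑ X with φ X = G i, ∏ j, Q (X j)) + n * η := by
    intro i
    -- The product of the `f i` is dominated by that of `Q`, which all models share; by Bernoulli's
    -- inequality the rest has mass at most 1 - (1 - η) ^ n ≤ n η.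
    have h1 : ∀ X : Fin n → Config p, ∏ j, isingPMF (θ (G i)) (X j) ≤ ∏ j, Q (X j) +
        (∏ j, isingPMF (θ (G i)) (X j) - ∏ j, f i (X j)) := fun X => by
      have := Finset.prod_le_prod (s := Finset.univ) (fun j _ => hf i (X j))
        fun j _ => hfQ i (X j)
      linarith
    refine (Finset.sum_le_sum fun X _ => h1 X).trans ?_
    rw [Finset.sum_add_distrib]
    gcongr
    refine (Finset.sum_le_sum_of_subset_of_nonneg (Finset.subset_univ _) fun X _ _ =>
      sub_nonneg.2 (Finset.prod_le_prod (fun j _ => hf i (X j)) fun j _ => hfP i (X j))).trans ?_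
    rw [Finset.sum_sub_distrib, sum_prod_isingPMF, ← Fintype.sum_pow]
    have h2 := one_add_mul_le_pow (a := -η) (by linarith) n
    have h3 := pow_le_pow_left₀ (by linarith) (hη i) n
    rw [← sub_eq_add_neg] at h2
    linarith
  have h1 := Finset.sum_le_sum fun i (_ : i ∈ Finset.univ) => hout i
  rw [Finset.sum_add_distrib, Finset.sum_const, nsmul_eq_mul, Finset.card_univ] at h1
  have h2 := sum_sum_filter_decoder_le φ hG (f := fun X : Fin n → Config p => ∏ j, Q (X j))
    fun X => Finset.prod_nonneg fun j _ => hQ0 (X j)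
  rw [← Fintype.sum_pow] at h2
  have h3 := pow_le_one₀ (n := n) (Finset.sum_nonneg fun x (_ : x ∈ Finset.univ) => hQ0 x) hQ
  have h4 : ∑ _i : ι, (1 / 2 : ℝ) < ∑ i, outputProb φ (θ (G i)) (G i) :=
    Finset.sum_lt_sum_of_nonempty Finset.univ_nonempty fun i _ => by
      linarith [hcon (G i), outputProb_add_errorProb φ (G i) (θ (G i))]
  rw [Finset.sum_const, nsmul_eq_mul, Finset.card_univ] at h4
  linarith

/-- A decoder with too few inputs cannot recover too many graphs. -/
theorem exists_half_le_errorProb_of_card {p d n : ℕ} {ι : Type*} [Fintype ι] [Nonempty ι]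
    {θ : BoundedDegreeGraph p d → Weights p} {G : ι → BoundedDegreeGraph p d}
    (hG : Function.Injective G) (hcard : 2 * 2 ^ (n * p) ≤ Fintype.card ι)
    (φ : Decoder p d n) : ∃ H, 1 / 2 ≤ errorProb φ H (θ H) := by
  classical
  by_contra! hcon
  -- Each data set has probability at most 1 under any model and is decoded to one graph, so the
  -- success probabilities sum to at most the number of data sets.
  have h1 : ∀ i, outputProb φ (θ (G i)) (G i) ≤ ∑ X with φ X = G i, (1 : ℝ) := fun i =>
    Finset.sum_le_sum fun X _ => Finset.prod_le_one (fun j _ => (isingPMF_pos _ _).le) fun j _ =>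
      (Finset.single_le_sum (fun x _ => (isingPMF_pos _ x).le) (Finset.mem_univ (X j))).trans_eq
        (sum_isingPMF _)
  have h2 := (Finset.sum_le_sum fun i (_ : i ∈ Finset.univ) => h1 i).trans
    (sum_sum_filter_decoder_le φ hG fun _ => zero_le_one)
  have h3 : ∑ _X : Fin n → Config p, (1 : ℝ) = 2 ^ (n * p) := by
    simp [← pow_mul, mul_comm]
  have h4 : ∑ _i : ι, (1 / 2 : ℝ) < ∑ i, outputProb φ (θ (G i)) (G i) :=
    Finset.sum_lt_sum_of_nonempty Finset.univ_nonempty fun i _ => by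
      linarith [hcon (G i), outputProb_add_errorProb φ (G i) (θ (G i))]
  rw [Finset.sum_const, nsmul_eq_mul, Finset.card_univ] at h4
  have h5 : (2 * 2 ^ (n * p) : ℝ) ≤ Fintype.card ι := by exact_mod_cast hcard
  linarith

/-! ### Admissible weights -/

/-- The conclusion for known edge weights. -/
def KnownWeightsBound (p d n : ℕ) (lam ω : ℝ) : Prop :=
  ∃ θ : BoundedDegreeGraph p d → Weights p, (∀ G, Admissible lam ω G.1 (θ G)) ∧
    ∀ φ : Decoder p d n, ∃ G, 1 / 2 ≤ errorProb φ G (θ G)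

open Classical in
theorem Admissible.of_degree_le {p k : ℕ} {lam ω c : ℝ} {G : SimpleGraph (Fin p)}
    {θ : Weights p} (hsupp : ∀ e, θ e ≠ 0 → e ∈ G.edgeSet)
    (hmin : ∀ e ∈ G.edgeSet, lam ≤ |θ e|) (hdeg : ∀ v, G.degree v ≤ k) (hc : ∀ e, |θ e| ≤ c)
    (hc0 : 0 ≤ c) (hkc : k * c ≤ ω) : Admissible lam ω G θ := by
  refine ⟨hsupp, hmin, fun s => ?_⟩
  refine (Finset.sum_le_sum fun t _ => hc _).trans ?_
  rw [Finset.sum_const, nsmul_eq_mul, SimpleGraph.card_neighborFinset_eq_degree]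
  refine le_trans ?_ hkc
  gcongr
  exact_mod_cast hdeg s

/-- Prescribed admissible weights on a family of distinct graphs extend to all graphs. -/
theorem exists_admissible_extension {p d : ℕ} {lam ω : ℝ} (hlam : 0 < lam)
    (hlamω : lam * d ≤ ω) {ι : Type*} {G : ι → BoundedDegreeGraph p d}
    (hG : Function.Injective G) {w : ι → Weights p}
    (hw : ∀ i, Admissible lam ω (G i).1 (w i)) :
    ∃ θ : BoundedDegreeGraph p d → Weights p, (∀ G, Admissible lam ω G.1 (θ G)) ∧
      ∀ i, θ (G i) = w i := by
  classical
  refine ⟨Function.extend G w fun H e => if e ∈ H.1.edgeSet then lam else 0, fun H => ?_,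
    fun i => hG.extend_apply _ _ i⟩
  by_cases hH : ∃ i, G i = H
  · obtain ⟨i, rfl⟩ := hH
    rw [hG.extend_apply]
    exact hw i
  · rw [Function.extend_apply' _ _ _ hH]
    refine Admissible.of_degree_le (k := d) (c := lam) (fun e he => ?_) (fun e he => ?_) H.2
      (fun e => ?_) hlam.le (by linarith)
    · by_contra h
      simp [h] at he
    · rw [if_pos he, abs_of_pos hlam]
    · split_ifs
      · rw [abs_of_pos hlam]
      · simpa using hlam.le

/-- The graph whose edges are the pairs with nonzero weight. -/
def supportGraph {p : ℕ} (θ : Weights p) : SimpleGraph (Fin p) :=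
  SimpleGraph.fromEdgeSet {e | θ e ≠ 0}

open Classical in
theorem degree_supportGraph_le {p k : ℕ} {θ : Weights p} {v : Fin p} {T : Finset (Fin p)}
    (hT : T.card ≤ k) (h : ∀ u, u ≠ v → θ s(v, u) ≠ 0 → u ∈ T) :
    (supportGraph θ).degree v ≤ k := by
  refine le_trans ?_ hT
  rw [← SimpleGraph.card_neighborFinset_eq_degree]
  refine Finset.card_le_card fun u hu => ?_
  have := (SimpleGraph.mem_neighborFinset _ _ _).1 hu
  rw [supportGraph, SimpleGraph.fromEdgeSet_adj] at this
  exact h u this.2.symm this.1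

open Classical in
theorem admissible_supportGraph {p k : ℕ} {lam ω c : ℝ} {θ : Weights p}
    (hdiag : ∀ e, θ e ≠ 0 → ¬ e.IsDiag) (hmin : ∀ e, θ e ≠ 0 → lam ≤ |θ e|)
    (hdeg : ∀ v, (supportGraph θ).degree v ≤ k) (hc : ∀ e, |θ e| ≤ c) (hc0 : 0 ≤ c)
    (hkc : k * c ≤ ω) : Admissible lam ω (supportGraph θ) θ := by
  refine Admissible.of_degree_le (fun e he => ?_) (fun e he => hmin e ?_) hdeg hc hc0 hkc
  · rw [supportGraph, SimpleGraph.edgeSet_fromEdgeSet]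
    exact ⟨he, hdiag e he⟩
  · rw [supportGraph, SimpleGraph.edgeSet_fromEdgeSet] at he
    exact he.1

theorem ne_zero_iff_of_supportGraph_eq {p : ℕ} {θ θ' : Weights p}
    (h : supportGraph θ = supportGraph θ') {e : Sym2 (Fin p)} (he : ¬ e.IsDiag) :
    θ e ≠ 0 ↔ θ' e ≠ 0 := by
  have h1 := congrArg (fun G => e ∈ SimpleGraph.edgeSet G) h
  simpa [supportGraph, he] using h1

/-! ### Too few samples for the number of vertices: graphs with a single edge -/

theorem degree_supportGraph_single_le {p : ℕ} (e : Sym2 (Fin p)) (c : ℝ) (v : Fin p) :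
    (open Classical in (supportGraph (Pi.single e c)).degree v ≤ 1) := by
  induction e with
  | h a b =>
  refine degree_supportGraph_le (T := {if v = a then b else a}) (by simp) fun u hu he => ?_
  have : s(v, u) = s(a, b) := by
    by_contra hne
    simp [hne] at he
  rw [Finset.mem_singleton]
  rcases Sym2.eq_iff.1 this with h | h
  · simp [h.1, h.2]
  · simp only [h.1, h.2]
    split_ifs with hab
    · rw [hab]
    · rfl

/-- With m = p(p - 1)/2 ≥ p, the right side exceeds m/2 ≥ p/2 ≥ √p once p ≥ 4. For p = 3 it is 9/5 >
√3; for p = 2 the bound fails. -/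
theorem sqrt_le_sq_div_two_mul_sub_one {p : ℕ} (hp : 3 ≤ p) :
    √(p : ℝ) ≤ (p.choose 2 : ℝ) ^ 2 / (2 * p.choose 2 - 1) := by
  have hm : (p.choose 2 : ℝ) = p * (p - 1) / 2 := Nat.cast_choose_two ℝ p
  have hp' : (3 : ℝ) ≤ p := by exact_mod_cast hp
  set m : ℝ := (p.choose 2 : ℝ)
  have hm1 : (p : ℝ) ≤ m := by nlinarith
  rw [le_div_iff₀ (by linarith)]
  rcases hp.eq_or_lt with h | h
  · rw [← h] at hm ⊢
    rw [hm]
    have : √((3 : ℕ) : ℝ) ≤ 9 / 5 := by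
      rw [Real.sqrt_le_left (by norm_num)]; norm_num
    norm_num at *
    linarith
  · have h4 : (4 : ℝ) ≤ p := by exact_mod_cast h
    have hs : √(p : ℝ) ≤ p / 2 := by
      rw [Real.sqrt_le_left (by linarith)]; nlinarith
    nlinarith

theorem knownWeightsBound_of_single_edges {p d n : ℕ} {lam ω : ℝ} (hp : 3 ≤ p) (hd : 1 ≤ d)
    (hlam : 0 < lam) (hlamω : lam * d ≤ ω) (hn : (1 + Real.tanh lam ^ 2) ^ n ≤ √(p : ℝ)) :
    KnownWeightsBound p d n lam ω := by
  classical
  have hd' : (1 : ℝ) ≤ d := by exact_mod_cast hd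
  let w : Option {e : Sym2 (Fin p) // ¬ e.IsDiag} → Weights p :=
    fun o => o.elim 0 fun e => Pi.single e.1 lam
  have hdeg : ∀ o v, (supportGraph (w o)).degree v ≤ 1 := by
    rintro (_ | e) v
    · exact degree_supportGraph_le (T := ∅) (by simp) fun u _ h => absurd rfl h
    · exact degree_supportGraph_single_le _ _ _
  let G : Option {e : Sym2 (Fin p) // ¬ e.IsDiag} → BoundedDegreeGraph p d :=
    fun o => ⟨supportGraph (w o), fun v => (hdeg o v).trans hd⟩
  have hmem : ∀ o (e : Sym2 (Fin p)), w o e ≠ 0 → ∃ h : ¬ e.IsDiag, o = some ⟨e, h⟩ := by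
    rintro (_ | f) e he
    · exact absurd rfl he
    · have : e = f.1 := by
        by_contra hne
        exact he (Pi.single_eq_of_ne hne _)
      subst this
      exact ⟨f.2, rfl⟩
  have hself : ∀ e, w (some e) e.1 = lam := fun e => Pi.single_eq_same _ _
  have hG : Function.Injective G := by
    intro o o' h
    have h' := fun (e : {e : Sym2 (Fin p) // ¬ e.IsDiag}) =>
      ne_zero_iff_of_supportGraph_eq (congrArg Subtype.val h) e.2
    rcases o with _ | e
    · rcases o' with _ | e'
      · rfl
      · exact absurd rfl ((h' e').2 (by rw [hself]; exact hlam.ne'))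
    · obtain ⟨_, h2⟩ := hmem o' e.1 ((h' e).1 (by rw [hself]; exact hlam.ne'))
      exact h2.symm
  have hadm : ∀ o, Admissible lam ω (G o).1 (w o) := by
    intro o
    have hval : ∀ e, w o e ≠ 0 → w o e = lam := fun e he => by
      obtain ⟨_, rfl⟩ := hmem o e he
      exact hself _
    refine admissible_supportGraph (k := 1) (c := lam) (fun e he => (hmem o e he).1)
      (fun e he => ?_) (hdeg o) (fun e => ?_) hlam.le (by push_cast; nlinarith)
    · rw [hval e he, abs_of_pos hlam]
    · by_cases he : w o e = 0
      · rw [he, abs_zero]; exact hlam.le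
      · rw [hval e he, abs_of_pos hlam]
  obtain ⟨θ, hθ, hθG⟩ := exists_admissible_extension hlam hlamω hG hadm
  refine ⟨θ, hθ, fun φ => ?_⟩
  have : Nonempty {e : Sym2 (Fin p) // ¬ e.IsDiag} :=
    ⟨⟨s(⟨0, by omega⟩, ⟨1, by omega⟩), by simp⟩⟩
  refine exists_half_le_errorProb_of_chiSq hG (K := 1 + Real.tanh lam ^ 2) ?_ ?_ φ
  · rintro ⟨e, he⟩
    induction e with
    | h a b =>
    have hab : a ≠ b := by simpa using he
    rw [hθG, hθG]
    -- Without interactions `a` counts as a leaf at `b` with weight 0, so the correlation vanishes.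
    have hcorr := sum_exp_energy_mul_leaf (θ := (0 : Weights p)) (w := 0) hab rfl
      (fun _ _ => rfl) (F := fun x => ((x b : ℤ) : ℝ)) fun x => by rw [flipAt_of_ne hab.symm]
    rw [Real.tanh_zero, zero_mul] at hcorr
    have := sum_sq_isingPMF_add_single_div_le (0 : Weights p) hab hlam.le le_rfl
      (hcorr.trans (zero_mul _).symm)
    simpa [w] using this
  · have hcard : Fintype.card {e : Sym2 (Fin p) // ¬ e.IsDiag} = p.choose 2 := by
      rw [← Fintype.card_fin p, ← Sym2.card_subtype_not_diag, Fintype.card_fin]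
    rw [hcard]
    exact hn.trans (sqrt_le_sq_div_two_mul_sub_one hp)

/-! ### Strong interactions: paths on three vertices -/

/-- The vertices are cut into blocks of three consecutive ones; inside each block, every vertex
of `H` is joined to every vertex outside `H` with weight `w`. -/
noncomputable def hubWeights {p : ℕ} (H : Set (Fin p)) (w : ℝ) : Weights p :=
  open Classical in
  Sym2.lift ⟨fun a b => if (a : ℕ) / 3 = b / 3 ∧ ¬ (a ∈ H ↔ b ∈ H) then w else 0, fun _ _ =>
    if_congr (and_congr eq_comm (not_congr iff_comm)) rfl rfl⟩

theorem hubWeights_of_mem {p : ℕ} {H : Set (Fin p)} {w : ℝ} {a b : Fin p}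
    (hab : (a : ℕ) / 3 = b / 3) (ha : a ∉ H) (hb : b ∈ H) : hubWeights H w s(a, b) = w := by
  simp [hubWeights, hab, ha, hb]

theorem hubWeights_of_notMem {p : ℕ} {H : Set (Fin p)} {w : ℝ} {a b : Fin p}
    (ha : a ∉ H) (hb : b ∉ H) : hubWeights H w s(a, b) = 0 := by
  simp [hubWeights, ha, hb]

theorem hubWeights_eq {p : ℕ} {H : Set (Fin p)} {w : ℝ} {e : Sym2 (Fin p)}
    (h : hubWeights H w e ≠ 0) : hubWeights H w e = w := by
  induction e with
  | h a b =>
  simp only [hubWeights, Sym2.lift_mk] at h ⊢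
  split_ifs at h ⊢ with hc
  · rfl
  · exact absurd rfl h

theorem block_eq_of_hubWeights_ne_zero {p : ℕ} {H : Set (Fin p)} {w : ℝ} {a b : Fin p}
    (h : hubWeights H w s(a, b) ≠ 0) : (a : ℕ) / 3 = b / 3 ∧ ¬ (a ∈ H ↔ b ∈ H) := by
  simp only [hubWeights, Sym2.lift_mk] at h
  by_contra hc
  exact h (if_neg hc)

theorem ne_of_hubWeights_ne_zero {p : ℕ} {H : Set (Fin p)} {w : ℝ} {a b : Fin p}
    (h : hubWeights H w s(a, b) ≠ 0) : a ≠ b := by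
  rintro rfl
  simpa using (block_eq_of_hubWeights_ne_zero h).2

theorem card_block_erase_le {p : ℕ} (v : Fin p) :
    (Finset.univ.filter fun u : Fin p => u ≠ v ∧ (u : ℕ) / 3 = v / 3).card ≤ 2 := by
  have h := Finset.card_le_card_of_injOn (s := Finset.univ.filter
    fun u : Fin p => u ≠ v ∧ (u : ℕ) / 3 = v / 3)
    (t := (Finset.Ico (3 * ((v : ℕ) / 3)) (3 * ((v : ℕ) / 3) + 3)).erase v) Fin.val
    (fun u hu => by
      simp only [Finset.coe_filter, Set.mem_ofPred_eq, Finset.mem_univ, true_and] at hu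
      simp only [Finset.coe_erase, Finset.coe_Ico, Set.mem_sdiff, Set.mem_Ico,
        Set.mem_singleton_iff, Fin.val_inj]
      omega)
    Fin.val_injective.injOn
  rw [Finset.card_erase_of_mem (Finset.mem_Ico.2 (by omega)), Nat.card_Ico] at h
  omega

theorem degree_supportGraph_le_two {p : ℕ} {θ : Weights p}
    (h : ∀ a b : Fin p, θ s(a, b) ≠ 0 → (a : ℕ) / 3 = b / 3) (v : Fin p) :
    (open Classical in (supportGraph θ).degree v ≤ 2) :=
  degree_supportGraph_le (card_block_erase_le v) fun u hu he => by
    simp [hu, h v u he]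

section Correlation

variable {p : ℕ} {H : Set (Fin p)} {w : ℝ} {s t h : Fin p}

/-- In a block with a single hub every other vertex interacts with that hub only. -/
theorem sum_exp_energy_hubWeights_mul_leaf (hs : s ∉ H) (hh : h ∈ H)
    (hsh : (s : ℕ) / 3 = h / 3) (huniq : ∀ u ∈ H, (u : ℕ) / 3 = h / 3 → u = h)
    {F : Config p → ℝ} (hF : ∀ x, F (flipAt s x) = F x) :
    ∑ x, Real.exp (energy (hubWeights H w) x) * (((x s : ℤ) : ℝ) * F x) =
      Real.tanh w * ∑ x, Real.exp (energy (hubWeights H w) x) * (((x h : ℤ) : ℝ) * F x) := by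
  refine sum_exp_energy_mul_leaf (ne_of_mem_of_not_mem hh hs).symm (hubWeights_of_mem hsh hs hh)
    (fun u hu => ?_) hF
  by_contra hne
  obtain ⟨h1, h2⟩ := block_eq_of_hubWeights_ne_zero hne
  exact hu (huniq u (by tauto) (h1.symm.trans hsh))

theorem sum_exp_energy_hubWeights_leaf_hub (hs : s ∉ H) (hh : h ∈ H)
    (hsh : (s : ℕ) / 3 = h / 3) (huniq : ∀ u ∈ H, (u : ℕ) / 3 = h / 3 → u = h) :
    ∑ x, Real.exp (energy (hubWeights H w) x) * (((x s : ℤ) : ℝ) * ((x h : ℤ) : ℝ)) =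
      Real.tanh w * partitionFn (hubWeights H w) := by
  have hne : h ≠ s := fun h' => hs (h' ▸ hh)
  rw [sum_exp_energy_hubWeights_mul_leaf hs hh hsh huniq fun x => by rw [flipAt_of_ne hne]]
  simp only [spin_mul_self, mul_one, partitionFn]

/-- Both leaf spins are traded for the hub spin, each at the price of one factor tanh w. -/
theorem sum_exp_energy_hubWeights_leaf_leaf (hs : s ∉ H) (ht : t ∉ H) (hh : h ∈ H)
    (hst : s ≠ t) (hsh : (s : ℕ) / 3 = h / 3) (hth : (t : ℕ) / 3 = h / 3)
    (huniq : ∀ u ∈ H, (u : ℕ) / 3 = h / 3 → u = h) :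
    ∑ x, Real.exp (energy (hubWeights H w) x) * (((x s : ℤ) : ℝ) * ((x t : ℤ) : ℝ)) =
      Real.tanh w ^ 2 * partitionFn (hubWeights H w) := by
  rw [sum_exp_energy_hubWeights_mul_leaf hs hh hsh huniq
    fun x => by rw [flipAt_of_ne hst.symm], sq, mul_assoc,
    ← sum_exp_energy_hubWeights_leaf_hub ht hh hth huniq]
  simp only [mul_comm]

end Correlation

theorem one_sub_tanh_le (w : ℝ) : 1 - Real.tanh w ≤ 2 * Real.exp (-(2 * w)) := by
  have hc := Real.cosh_pos w
  rw [Real.tanh_eq_sinh_div_cosh, one_sub_div hc.ne', Real.cosh_sub_sinh, div_le_iff₀ hc,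
    Real.cosh_eq]
  have h1 : Real.exp (-(2 * w)) * Real.exp w = Real.exp (-w) := by
    rw [← Real.exp_add]; ring_nf
  have h2 := mul_pos (Real.exp_pos (-(2 * w))) (Real.exp_pos (-w))
  linarith

theorem tanh_sq_le_one (w : ℝ) : Real.tanh w ^ 2 ≤ 1 := by
  have := Real.cosh_pos w
  rw [Real.tanh_eq_sinh_div_cosh, div_pow, div_le_one (by positivity), Real.cosh_sq]
  linarith

/-- Closing one of many disjoint paths on three vertices to a triangle. -/
theorem knownWeightsBound_of_triangles {p d n : ℕ} {lam ω : ℝ} (hp : 3 ≤ p) (hd : 2 ≤ d)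
    (hlam : 0 < lam) (hlamω : lam * d ≤ ω)
    (hn : (1 + 8 * Real.exp (-ω)) ^ n ≤
      ((p / 3 : ℕ) : ℝ) ^ 2 / (2 * ((p / 3 : ℕ) : ℝ) - 1)) :
    KnownWeightsBound p d n lam ω := by
  classical
  have hd' : (2 : ℝ) ≤ d := by exact_mod_cast hd
  -- Hub edges get weight ω/2, so that two edges at a vertex just exhaust ω.
  have hlam2 : lam ≤ ω / 2 := by nlinarith
  set H : Set (Fin p) := {v | (v : ℕ) % 3 = 0} with hH
  let h (j : Fin (p / 3)) : Fin p := ⟨3 * j, by omega⟩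
  let s (j : Fin (p / 3)) : Fin p := ⟨3 * j + 1, by omega⟩
  let t (j : Fin (p / 3)) : Fin p := ⟨3 * j + 2, by omega⟩
  have hhH : ∀ j, h j ∈ H := fun j => by simp [H, h]
  have hsH : ∀ j, s j ∉ H := fun j => by simp only [H, s, Set.mem_ofPred_eq]; omega
  have htH : ∀ j, t j ∉ H := fun j => by simp only [H, t, Set.mem_ofPred_eq]; omega
  have hst : ∀ j, s j ≠ t j := fun j => by simp [s, t, Fin.ext_iff]
  have hsh : ∀ j, (s j : ℕ) / 3 = h j / 3 := fun j => by simp only [s, h]; omega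
  have hth : ∀ j, (t j : ℕ) / 3 = h j / 3 := fun j => by simp only [t, h]; omega
  have huniq : ∀ j, ∀ u ∈ H, (u : ℕ) / 3 = h j / 3 → u = h j := fun j u hu hu' => by
    simp only [H, Set.mem_ofPred_eq] at hu
    simp only [h, Fin.ext_iff] at hu' ⊢
    omega
  have hzero : ∀ j, hubWeights H (ω / 2) s(s j, t j) = 0 := fun j =>
    hubWeights_of_notMem (hsH j) (htH j)
  let w : Option (Fin (p / 3)) → Weights p := fun o =>
    o.elim (hubWeights H (ω / 2)) fun j => hubWeights H (ω / 2) + Pi.single s(s j, t j) lam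
  have hself : ∀ j, w (some j) s(s j, t j) = lam := fun j => by simp [w, hzero j]
  have hother : ∀ o e, (∀ j, o = some j → e ≠ s(s j, t j)) → w o e = hubWeights H (ω / 2) e := by
    rintro (_ | j) e he
    · rfl
    · simp [w, he j rfl]
  have hcases : ∀ o e, (∃ j, o = some j ∧ e = s(s j, t j)) ∨ w o e = hubWeights H (ω / 2) e := by
    intro o e
    by_cases he : ∃ j, o = some j ∧ e = s(s j, t j)
    · exact Or.inl he
    · exact Or.inr (hother o e fun j hj hj' => he ⟨j, hj, hj'⟩)
  have hblock : ∀ o (a b : Fin p), w o s(a, b) ≠ 0 → a ≠ b ∧ (a : ℕ) / 3 = b / 3 := by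
    intro o a b hab
    rcases hcases o s(a, b) with ⟨j, -, he⟩ | he
    · have h1 := (hsh j).trans (hth j).symm
      rcases Sym2.eq_iff.1 he with ⟨rfl, rfl⟩ | ⟨rfl, rfl⟩
      · exact ⟨hst j, h1⟩
      · exact ⟨(hst j).symm, h1.symm⟩
    · rw [he] at hab
      exact ⟨ne_of_hubWeights_ne_zero hab, (block_eq_of_hubWeights_ne_zero hab).1⟩
  have hdeg : ∀ o v, (supportGraph (w o)).degree v ≤ 2 := fun o =>
    degree_supportGraph_le_two fun a b hab => (hblock o a b hab).2
  let G : Option (Fin (p / 3)) → BoundedDegreeGraph p d :=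
    fun o => ⟨supportGraph (w o), fun v => (hdeg o v).trans hd⟩
  have hG : Function.Injective G := by
    have hmem : ∀ o j, w o s(s j, t j) ≠ 0 ↔ o = some j := by
      intro o j
      constructor
      · intro hne
        rcases hcases o s(s j, t j) with ⟨k, hk, he⟩ | he
        · have : j = k := by
            rcases Sym2.eq_iff.1 he with h' | h' <;>
              simp only [s, t, Fin.ext_iff] at h' ⊢ <;> omega
          rw [hk, this]
        · exact absurd (he.trans (hzero j)) hne
      · rintro rfl
        rw [hself]
        exact hlam.ne'
    intro o o' hoo
    have h' := fun j => (hmem o j).symm.trans ((ne_zero_iff_of_supportGraph_eq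
      (congrArg Subtype.val hoo) (by simpa using hst j)).trans (hmem o' j))
    exact Option.ext fun j => h' j
  have hadm : ∀ o, Admissible lam ω (G o).1 (w o) := by
    intro o
    have hval : ∀ e, w o e ≠ 0 → lam ≤ w o e ∧ w o e ≤ ω / 2 := by
      intro e hne
      rcases hcases o e with ⟨j, rfl, rfl⟩ | he
      · rw [hself]; exact ⟨le_rfl, hlam2⟩
      · rw [he] at hne ⊢
        rw [hubWeights_eq hne]; exact ⟨hlam2, le_rfl⟩
    refine admissible_supportGraph (k := 2) (c := ω / 2) (fun e he => ?_)
      (fun e he => (hval e he).1.trans (le_abs_self _)) (hdeg o) (fun e => ?_) (by linarith)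
      (by push_cast; linarith)
    · induction e with
      | h a b => simpa using (hblock o a b he).1
    · by_cases he : w o e = 0
      · rw [he, abs_zero]; linarith
      · rw [abs_of_pos (by linarith [(hval e he).1])]; exact (hval e he).2
  obtain ⟨θ, hθ, hθG⟩ := exists_admissible_extension hlam hlamω hG hadm
  refine ⟨θ, hθ, fun φ => ?_⟩
  have : Nonempty (Fin (p / 3)) := ⟨⟨0, by omega⟩⟩
  refine exists_half_le_errorProb_of_chiSq hG (K := 1 + 8 * Real.exp (-ω)) (fun j => ?_)
    (by simpa using hn) φ
  rw [hθG, hθG]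
  refine (sum_sq_isingPMF_add_single_div_le (hubWeights H (ω / 2)) (hst j) hlam.le
    (sq_nonneg _) (sum_exp_energy_hubWeights_leaf_leaf (hsH j) (htH j) (hhH j) (hst j) (hsh j)
      (hth j) (huniq j))).trans ?_
  -- With t = tanh (ω/2): 1 - t⁴ ≤ 4 (1 - t) ≤ 8 exp(-ω).
  have h1 := one_sub_tanh_le (ω / 2)
  rw [mul_div_cancel₀ ω two_ne_zero] at h1
  have h2 := tanh_sq_le_one (ω / 2)
  have h3 := tanh_sq_le_one lam
  have h4 : Real.tanh (ω / 2) ≤ 1 := by nlinarith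
  nlinarith [mul_nonneg (sub_nonneg.2 h3) (by nlinarith [sq_nonneg (Real.tanh (ω / 2))] :
    0 ≤ 1 - (Real.tanh (ω / 2) ^ 2) ^ 2), sq_nonneg (1 - Real.tanh (ω / 2)),
    sq_nonneg (1 - Real.tanh (ω / 2) ^ 2)]

theorem card_mul_le_one_of_const {Ω : Type*} [Fintype Ω] {f : Ω → ℝ} (hf : ∀ x, 0 ≤ f x)
    (hsum : ∑ x, f x = 1) {s : Finset Ω} {c : ℝ} (hc : ∀ x ∈ s, f x = c) : s.card * c ≤ 1 := by
  rw [← hsum, ← nsmul_eq_mul, ← Finset.sum_const, ← Finset.sum_congr rfl hc]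
  exact Finset.sum_le_sum_of_subset_of_nonneg (Finset.subset_univ _) fun x _ _ => hf x

/-- The three paths on a set of three vertices are hard to tell apart. -/
theorem knownWeightsBound_of_paths {p d n : ℕ} {lam ω : ℝ} (hp : 3 ≤ p) (hd : 2 ≤ d)
    (hlam : 0 < lam) (hlamω : lam * d ≤ ω) (hn : n * (2 * Real.exp (-ω)) ≤ 1 / 6) :
    KnownWeightsBound p d n lam ω := by
  classical
  have hd' : (2 : ℝ) ≤ d := by exact_mod_cast hd
  have hlam2 : lam ≤ ω / 2 := by nlinarith
  have hω : 0 < ω / 2 := by linarith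
  let c : Fin 3 → Fin p := Fin.castLE hp
  have hc : Function.Injective c := Fin.castLE_injective hp
  have hcb : ∀ i, (c i : ℕ) / 3 = 0 := fun i => by simp [c, Fin.val_castLE]
  have hcs : ∀ v : Fin p, (v : ℕ) / 3 = 0 → ∃ i, v = c i := fun v hv =>
    ⟨⟨v, by omega⟩, by simp [c]⟩
  let w : Fin 3 → Weights p := fun i => hubWeights {c i} (ω / 2)
  have hdeg : ∀ i v, (supportGraph (w i)).degree v ≤ 2 := fun i =>
    degree_supportGraph_le_two fun a b hab => (block_eq_of_hubWeights_ne_zero hab).1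
  let G : Fin 3 → BoundedDegreeGraph p d :=
    fun i => ⟨supportGraph (w i), fun v => (hdeg i v).trans hd⟩
  have hother : ∀ {i j : Fin 3}, j ≠ i → c j ∉ ({c i} : Set (Fin p)) := fun h h' => h (hc h')
  have hG : Function.Injective G := by
    intro i j hij
    by_contra hne
    obtain ⟨k, hki, hkj⟩ : ∃ k : Fin 3, k ≠ i ∧ k ≠ j := by
      have : ∀ i j : Fin 3, i ≠ j → ∃ k : Fin 3, k ≠ i ∧ k ≠ j := by decide
      exact this i j hne
    have h1 := ne_zero_iff_of_supportGraph_eq (congrArg Subtype.val hij)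
      (e := s(c k, c i)) (by simpa using fun h => hki (hc h))
    have h2 : w i s(c k, c i) = ω / 2 := hubWeights_of_mem (by simp [hcb]) (hother hki) rfl
    have h3 : w j s(c k, c i) = 0 := hubWeights_of_notMem (hother hkj) (hother hne)
    rw [h2, h3] at h1
    exact h1.1 hω.ne' rfl
  have hadm : ∀ i, Admissible lam ω (G i).1 (w i) := by
    intro i
    refine admissible_supportGraph (k := 2) (c := ω / 2) (fun e he => ?_) (fun e he => ?_)
      (hdeg i) (fun e => ?_) hω.le (by push_cast; linarith)
    · induction e with
      | h a b => simpa using ne_of_hubWeights_ne_zero he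
    · rw [show w i e = ω / 2 from hubWeights_eq he, abs_of_pos hω]; exact hlam2
    · by_cases he : w i e = 0
      · rw [he, abs_zero]; exact hω.le
      · rw [show w i e = ω / 2 from hubWeights_eq he, abs_of_pos hω]
  obtain ⟨θ, hθ, hθG⟩ := exists_admissible_extension hlam hlamω hG hadm
  refine ⟨θ, hθ, fun φ => ?_⟩
  -- On the event that the three spins agree, each path model is constant, hence at most 1 / |Al|:
  -- the uniform law on `Al` is the common majorant.
  let Al : Finset (Config p) := {x | ∀ i j, x (c i) = x (c j)}
  have hAl : ∀ x, x ∈ Al ↔ ∀ i j, x (c i) = x (c j) := fun x => by simp [Al]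
  have hAl0 : (0 : ℝ) < Al.card := by
    exact_mod_cast Finset.card_pos.2 ⟨fun _ => 1, (hAl _).2 fun _ _ => rfl⟩
  have henergy : ∀ i, ∀ x ∈ Al, energy (w i) x = ∑ a : Fin p, ∑ b ∈ Finset.Ioi a, w i s(a, b) := by
    intro i x hx
    refine Finset.sum_congr rfl fun a _ => Finset.sum_congr rfl fun b _ => ?_
    by_cases he : w i s(a, b) = 0
    · simp [he]
    · obtain ⟨h1, h2⟩ := block_eq_of_hubWeights_ne_zero he
      have hk : a = c i ∨ b = c i := by
        simp only [Set.mem_singleton_iff] at h2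
        tauto
      have hab : (a : ℕ) / 3 = 0 ∧ (b : ℕ) / 3 = 0 := by
        have := hcb i
        rcases hk with rfl | rfl <;> omega
      obtain ⟨a', rfl⟩ := hcs a hab.1
      obtain ⟨b', rfl⟩ := hcs b hab.2
      rw [(hAl x).1 hx a' b', mul_assoc, spin_mul_self, mul_one]
  refine exists_half_le_errorProb_of_common_part hG (η := 1 - Real.tanh (ω / 2))
    (f := fun i x => if x ∈ Al then isingPMF (w i) x else 0)
    (Q := fun x => if x ∈ Al then (Al.card : ℝ)⁻¹ else 0) ?_ (fun i x => ?_) (fun i x => ?_)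
    (fun i x => ?_) (fun i => ?_) ?_ ?_ φ
  · rw [← Finset.sum_filter, Finset.filter_mem_eq_inter, Finset.univ_inter, Finset.sum_const,
      nsmul_eq_mul, mul_inv_cancel₀ hAl0.ne']
  · split_ifs
    exacts [(isingPMF_pos _ _).le, le_rfl]
  · split_ifs with hx
    · rw [le_inv_comm₀ (isingPMF_pos _ _) hAl0, ← one_div, le_div_iff₀ (isingPMF_pos _ _)]
      refine card_mul_le_one_of_const (fun y => (isingPMF_pos (w i) y).le) (sum_isingPMF _)
        fun y hy => ?_
      rw [isingPMF, isingPMF, henergy i y hy, henergy i x hx]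
    · exact le_rfl
  · rw [hθG]; split_ifs
    exacts [le_rfl, (isingPMF_pos _ _).le]
  · obtain ⟨j, k, hji, hki, hall⟩ : ∃ j k : Fin 3, j ≠ i ∧ k ≠ i ∧
        ∀ l, l = i ∨ l = j ∨ l = k := by
      have : ∀ i : Fin 3, ∃ j k : Fin 3, j ≠ i ∧ k ≠ i ∧ ∀ l, l = i ∨ l = j ∨ l = k := by decide
      exact this i
    have hcorr : ∀ {j : Fin 3}, j ≠ i → ∑ x, isingPMF (w i) x *
        (((x (c j) : ℤ) : ℝ) * ((x (c i) : ℤ) : ℝ)) = Real.tanh (ω / 2) := by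
      intro j hj
      have := sum_exp_energy_hubWeights_leaf_hub (w := ω / 2) (hother hj) (Set.mem_singleton (c i))
        (by simp [hcb]) fun u hu _ => hu
      simp only [isingPMF, div_mul_eq_mul_div, ← Finset.sum_div]
      rw [div_eq_iff (partitionFn_pos _).ne']
      exact this
    -- The mean of the two leaf-hub products is 1 on `Al` and at most 0 elsewhere, so its
    -- expectation tanh (ω/2) bounds the mass of `Al` from below.
    have h1 : Real.tanh (ω / 2) = ∑ x, isingPMF (w i) x *
        ((((x (c j) : ℤ) : ℝ) * ((x (c i) : ℤ) : ℝ) +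
          ((x (c k) : ℤ) : ℝ) * ((x (c i) : ℤ) : ℝ)) / 2) := by
      simp only [← mul_div_assoc, mul_add, ← Finset.sum_div, Finset.sum_add_distrib]
      rw [hcorr hji, hcorr hki]
      ring
    rw [sub_sub_cancel, h1]
    refine Finset.sum_le_sum fun x _ => ?_
    have hpos := isingPMF_pos (w i) x
    split_ifs with hx
    · refine mul_le_of_le_one_right hpos.le ?_
      rw [(hAl x).1 hx j i, (hAl x).1 hx k i, spin_mul_self]
      norm_num
    · refine mul_nonpos_of_nonneg_of_nonpos hpos.le ?_
      have : x (c j) ≠ x (c i) ∨ x (c k) ≠ x (c i) := by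
        by_contra! hcon
        have h2 : ∀ l, x (c l) = x (c i) := fun l => by
          rcases hall l with rfl | rfl | rfl
          exacts [rfl, hcon.1, hcon.2]
        exact hx ((hAl x).2 fun l l' => (h2 l).trans (h2 l').symm)
      rcases Int.units_eq_one_or (x (c i)) with e1 | e1 <;>
        rcases Int.units_eq_one_or (x (c j)) with e2 | e2 <;>
          rcases Int.units_eq_one_or (x (c k)) with e3 | e3 <;>
            simp [e1, e2, e3] at this ⊢
  · have := div_pos (Real.sinh_pos_iff.2 hω) (Real.cosh_pos (ω / 2))
    rw [← Real.tanh_eq_sinh_div_cosh] at this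
    linarith
  · have h1 := one_sub_tanh_le (ω / 2)
    rw [mul_div_cancel₀ ω two_ne_zero] at h1
    have h2 := mul_le_mul_of_nonneg_left h1 (Nat.cast_nonneg (α := ℝ) n)
    rw [Fintype.card_fin]
    push_cast
    linarith

/-! ### Many graphs -/

/-- The vertices in the range of `f` are arranged in `2 * d` blocks of size `k`; a permutation
for each pair of a left and a right block gives a perfect matching between the two. -/
def matchingGraph {p d k : ℕ} (f : Bool × Fin d × Fin k ↪ Fin p)
    (σ : Fin d × Fin d → Equiv.Perm (Fin k)) : SimpleGraph (Fin p) :=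
  SimpleGraph.fromEdgeSet
    {e | ∃ i j x, e = s(f (false, i, x), f (true, j, σ (i, j) x))}

theorem matchingGraph_adj_iff {p d k : ℕ} (f : Bool × Fin d × Fin k ↪ Fin p)
    (σ : Fin d × Fin d → Equiv.Perm (Fin k)) (i j : Fin d) (x y : Fin k) :
    (matchingGraph f σ).Adj (f (false, i, x)) (f (true, j, y)) ↔ σ (i, j) x = y := by
  rw [matchingGraph, SimpleGraph.fromEdgeSet_adj]
  constructor
  · rintro ⟨⟨i', j', x', h⟩, -⟩
    rcases Sym2.eq_iff.1 h with ⟨h1, h2⟩ | ⟨h1, h2⟩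
    · have h1 := f.injective h1
      have h2 := f.injective h2
      simp only [Prod.mk.injEq, true_and] at h1 h2
      obtain ⟨rfl, rfl⟩ := h1
      obtain ⟨rfl, rfl⟩ := h2
      rfl
    · simpa using f.injective h1
  · rintro rfl
    exact ⟨⟨i, j, x, rfl⟩, fun h => by simpa using f.injective h⟩

open Classical in
-- A vertex has exactly one partner in each of the d blocks on the opposite side.
theorem degree_matchingGraph_le {p d k : ℕ} (f : Bool × Fin d × Fin k ↪ Fin p)
    (σ : Fin d × Fin d → Equiv.Perm (Fin k)) (v : Fin p) : (matchingGraph f σ).degree v ≤ d := by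
  rw [← SimpleGraph.card_neighborFinset_eq_degree]
  have hadj : ∀ u, (matchingGraph f σ).Adj v u →
      ∃ i j x, (v = f (false, i, x) ∧ u = f (true, j, σ (i, j) x)) ∨
        (v = f (true, j, σ (i, j) x) ∧ u = f (false, i, x)) := by
    intro u hu
    rw [matchingGraph, SimpleGraph.fromEdgeSet_adj] at hu
    obtain ⟨⟨i, j, x, h⟩, -⟩ := hu
    exact ⟨i, j, x, Sym2.eq_iff.1 h⟩
  by_cases hv : ∃ b, f b = v
  · obtain ⟨⟨c, l, y⟩, rfl⟩ := hv
    let g : Fin d → Fin p := fun j =>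
      if c then f (false, j, (σ (j, l)).symm y) else f (true, j, σ (l, j) y)
    refine (Finset.card_le_card (t := Finset.univ.image g) fun u hu => ?_).trans
      (Finset.card_image_le.trans (by simp))
    obtain ⟨i, j, x, ⟨h1, rfl⟩ | ⟨h1, rfl⟩⟩ := hadj u ((SimpleGraph.mem_neighborFinset _ _ _).1 hu)
    · have h1 := f.injective h1
      simp only [Prod.mk.injEq] at h1
      obtain ⟨rfl, rfl, rfl⟩ := h1
      exact Finset.mem_image.2 ⟨j, Finset.mem_univ _, by simp [g]⟩
    · have h1 := f.injective h1
      simp only [Prod.mk.injEq] at h1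
      obtain ⟨rfl, rfl, rfl⟩ := h1
      exact Finset.mem_image.2 ⟨i, Finset.mem_univ _, by simp [g]⟩
  · rw [Finset.card_eq_zero.2]
    · exact Nat.zero_le _
    · refine Finset.eq_empty_of_forall_notMem fun u hu => hv ?_
      obtain ⟨i, j, x, ⟨h1, -⟩ | ⟨h1, -⟩⟩ := hadj u ((SimpleGraph.mem_neighborFinset _ _ _).1 hu)
      exacts [⟨_, h1.symm⟩, ⟨_, h1.symm⟩]

theorem knownWeightsBound_of_matchings {p d n k : ℕ} {lam ω : ℝ} (hlam : 0 < lam)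
    (hlamω : lam * d ≤ ω) (hk : 2 * (d * k) ≤ p)
    (hn : 2 * 2 ^ (n * p) ≤ (k.factorial) ^ (d * d)) : KnownWeightsBound p d n lam ω := by
  classical
  have hcard : Fintype.card (Bool × Fin d × Fin k) ≤ Fintype.card (Fin p) := by simpa using hk
  obtain ⟨f⟩ := Function.Embedding.nonempty_of_card_le hcard
  let G : (Fin d × Fin d → Equiv.Perm (Fin k)) → BoundedDegreeGraph p d := fun σ =>
    ⟨matchingGraph f σ, degree_matchingGraph_le f σ⟩
  have hG : Function.Injective G := by
    intro σ τ h
    ext ⟨i, j⟩ x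
    have h1 := congrArg Subtype.val h
    have h2 := (matchingGraph_adj_iff f σ i j x _).2 rfl
    rw [show matchingGraph f σ = matchingGraph f τ from h1, matchingGraph_adj_iff] at h2
    rw [h2]
  -- Counting ignores the weights, so no graph needs a prescribed one.
  obtain ⟨θ, hθ, -⟩ := exists_admissible_extension (ι := Empty) (G := fun e => e.elim)
    (w := fun e => e.elim) hlam hlamω (fun e => e.elim) fun e => e.elim
  refine ⟨θ, hθ, fun φ => exists_half_le_errorProb_of_card hG ?_ φ⟩
  simpa [Fintype.card_perm] using hn

/-- From (k+1)^(k+1) / (k+1)! ≤ e^(k+1) ≤ 4^(k+1), and (k+1)! ≤ (k!)² because k + 1 ≤ k! for k ≥ 4.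
-/
theorem div_four_pow_le_factorial_sq {k : ℕ} (hk : 4 ≤ k) :
    (((k : ℝ) + 1) / 4) ^ (k + 1) ≤ (k.factorial : ℝ) ^ 2 := by
  have h1 := Real.pow_div_factorial_le_exp (((k + 1 : ℕ) : ℝ)) (by positivity) (k + 1)
  have hf : ((k + 1).factorial : ℝ) ≤ (k.factorial : ℝ) ^ 2 := by
    rw [Nat.factorial_succ, sq]
    push_cast
    gcongr
    have : ∀ k, 4 ≤ k → k + 1 ≤ k.factorial := by
      intro k hk
      induction k, hk using Nat.le_induction with
      | base => decide
      | succ m hm ih =>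
        rw [Nat.factorial_succ]
        nlinarith
    exact_mod_cast this k hk
  have he : Real.exp ((k + 1 : ℕ) : ℝ) ≤ 4 ^ (k + 1) := by
    rw [← mul_one (((k + 1 : ℕ) : ℝ)), Real.exp_nat_mul]
    have := Real.exp_one_lt_d9
    exact pow_le_pow_left₀ (Real.exp_pos _).le (by linarith) _
  rw [div_pow, div_le_iff₀ (by positivity)]
  rw [div_le_iff₀ (by positivity)] at h1
  push_cast at h1 he
  calc _ ≤ _ := h1
    _ ≤ 4 ^ (k + 1) * (k.factorial : ℝ) ^ 2 := by gcongr
    _ = _ := mul_comm _ _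

theorem knownWeightsBound_of_le_boundC {p d n : ℕ} {lam ω : ℝ} (hd : 1 ≤ d) (hlam : 0 < lam)
    (hlamω : lam * d ≤ ω) (hn0 : 1 ≤ n) (hn : (n : ℝ) ≤ boundC p d) :
    KnownWeightsBound p d n lam ω := by
  have hd' : (1 : ℝ) ≤ d := by exact_mod_cast hd
  have hn0' : (1 : ℝ) ≤ n := by exact_mod_cast hn0
  rw [boundC] at hn
  have hlog : 0 < Real.log ((p : ℝ) / (8 * d)) := by
    by_contra! h
    nlinarith [mul_nonneg_of_nonpos_of_nonpos h (by linarith : -(d : ℝ) / 8 ≤ 0)]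
  have hp8 : 8 * d < p := by
    by_contra! h
    refine hlog.not_ge (Real.log_nonpos (by positivity) ?_)
    rw [div_le_one (by positivity)]
    exact_mod_cast h
  set k := p / (2 * d) with hk
  have hkp : 2 * d * k ≤ p := Nat.mul_div_le p (2 * d)
  have hpk : p < 2 * d * (k + 1) := Nat.lt_mul_div_succ p (by omega)
  have hk4 : 4 ≤ k := (Nat.le_div_iff_mul_le (by omega)).2 (by omega)
  refine knownWeightsBound_of_matchings hlam hlamω (k := k) (by rw [← mul_assoc]; exact hkp) ?_
  have hpk' : (p : ℝ) ≤ 2 * d * (k + 1) := by exact_mod_cast hpk.le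
  have hp0 : (0 : ℝ) < p := by exact_mod_cast (by omega : 0 < p)
  have hL : Real.log ((p : ℝ) / (8 * d)) ≤ Real.log (((k : ℝ) + 1) / 4) := by
    refine Real.log_le_log (by positivity) ?_
    rw [div_le_div_iff₀ (by positivity) (by norm_num)]
    linarith
  have hfac : ((k : ℝ) + 1) * Real.log (((k : ℝ) + 1) / 4) ≤ 2 * Real.log k.factorial := by
    have := Real.log_le_log (by positivity) (div_four_pow_le_factorial_sq hk4)
    rw [Real.log_pow, Real.log_pow] at this
    exact_mod_cast this
  have hfac0 : 0 ≤ Real.log k.factorial := Real.log_natCast_nonneg _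
  have hnp : (n : ℝ) * p ≤ d * d * Real.log k.factorial / 2 := by
    calc (n : ℝ) * p ≤ d / 8 * Real.log (((k : ℝ) + 1) / 4) * (2 * d * (k + 1)) := by
          refine mul_le_mul (hn.trans ?_) hpk' hp0.le ?_
          · gcongr
          · exact mul_nonneg (by positivity) (hlog.le.trans hL)
      _ = d * d / 4 * (((k : ℝ) + 1) * Real.log (((k : ℝ) + 1) / 4)) := by ring
      _ ≤ d * d / 4 * (2 * Real.log k.factorial) := by gcongr
      _ = _ := by ring
  have hnp1 : (1 : ℝ) ≤ n * p := by
    have : (1 : ℝ) ≤ p := by exact_mod_cast (by omega : 1 ≤ p)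
    nlinarith
  -- Since n p ≥ 1, the extra factor 2 is absorbed: (1 + n p) log 2 ≤ 2 n p ≤ d² log k!.
  have hfin : (2 : ℝ) * 2 ^ (n * p) ≤ (k.factorial : ℝ) ^ (d * d) := by
    rw [← Real.log_le_log_iff (by positivity) (by positivity), Real.log_mul (by norm_num)
      (by positivity), Real.log_pow, Real.log_pow]
    push_cast
    nlinarith [Real.log_two_lt_d9, Real.log_two_gt_d9]
  exact_mod_cast hfin

/-! ### The thresholds -/

/-- Without data the output is a constant, which misses one of two graphs. The weights `w` only
encode the empty and a one-edge graph. -/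
theorem knownWeightsBound_zero {p d : ℕ} {lam ω : ℝ} (hp : 2 ≤ p) (hd : 1 ≤ d)
    (hlam : 0 < lam) (hlamω : lam * d ≤ ω) : KnownWeightsBound p d 0 lam ω := by
  classical
  let e : Sym2 (Fin p) := s(⟨0, by omega⟩, ⟨1, by omega⟩)
  let w : Bool → Weights p := fun b => Pi.single e (if b then 1 else 0)
  let G : Bool → BoundedDegreeGraph p d := fun b =>
    ⟨supportGraph (w b), fun v => (degree_supportGraph_single_le e _ v).trans hd⟩
  have hG : Function.Injective G := by
    intro b c h
    have h1 := ne_zero_iff_of_supportGraph_eq (congrArg Subtype.val h) (e := e) (by simp [e])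
    revert h1
    cases b <;> cases c <;> simp [w]
  obtain ⟨θ, hθ, -⟩ := exists_admissible_extension (ι := Empty) (G := fun e => e.elim)
    (w := fun e => e.elim) hlam hlamω (fun e => e.elim) fun e => e.elim
  refine ⟨θ, hθ, fun φ => ?_⟩
  exact exists_half_le_errorProb_of_common_part hG (η := 1) (f := fun _ _ => 0) (Q := fun _ => 0)
    (by simp) (fun _ _ => le_rfl) (fun _ _ => le_rfl) (fun _ _ => (isingPMF_pos _ _).le)
    (by simp) le_rfl (by simp) φ

theorem tanh_le_self {x : ℝ} (hx : 0 ≤ x) : Real.tanh x ≤ x := by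
  rw [Real.tanh_eq_sinh_div_cosh, div_le_iff₀ (Real.cosh_pos x)]
  refine hasSum_le (fun n => ?_) (Real.hasSum_sinh x) ((Real.hasSum_cosh x).mul_left x)
  rw [pow_succ, ← mul_div_assoc, mul_comm x]
  gcongr
  omega

theorem one_add_tanh_sq_pow_le_sqrt {p n : ℕ} {lam : ℝ} (hp : 1 ≤ p)
    (h : n * Real.tanh lam ^ 2 ≤ Real.log p / 2) :
    (1 + Real.tanh lam ^ 2) ^ n ≤ √(p : ℝ) := by
  have hp' : (0 : ℝ) < p := by exact_mod_cast hp
  calc (1 + Real.tanh lam ^ 2) ^ n ≤ Real.exp (Real.tanh lam ^ 2) ^ n := by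
        gcongr
        linarith [Real.add_one_le_exp (Real.tanh lam ^ 2)]
    _ = Real.exp (n * Real.tanh lam ^ 2) := by rw [← Real.exp_nat_mul]
    _ ≤ Real.exp (Real.log p / 2) := Real.exp_le_exp.2 h
    _ = √(p : ℝ) := by rw [Real.exp_half, Real.exp_log hp']

theorem mul_tanh_sq_le_of_le_boundA {p n : ℕ} {lam : ℝ} (hlam : 0 < lam)
    (h : (n : ℝ) ≤ boundA p lam) : n * Real.tanh lam ^ 2 ≤ Real.log p / 2 := by
  have ht : 0 < Real.tanh lam := by
    rw [Real.tanh_eq_sinh_div_cosh]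
    exact div_pos (Real.sinh_pos_iff.2 hlam) (Real.cosh_pos lam)
  rw [boundA, le_div_iff₀ (by positivity)] at h
  have := mul_le_mul_of_nonneg_left (tanh_le_self hlam.le)
    (mul_nonneg (Nat.cast_nonneg (α := ℝ) n) ht.le)
  nlinarith

/-- For x > 0, exp y ≥ e y at y = 3x/4, and 3e/4 > 2. -/
theorem two_mul_le_exp (x : ℝ) : 2 * x ≤ Real.exp (3 / 4 * x) := by
  rcases le_or_gt x 0 with hx | hx
  · linarith [Real.exp_pos (3 / 4 * x)]
  · have h1 := Real.add_one_le_exp (3 / 4 * x - 1)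
    have h2 : Real.exp (3 / 4 * x) = Real.exp (3 / 4 * x - 1) * Real.exp 1 := by
      rw [← Real.exp_add]; ring_nf
    have h3 := Real.exp_one_gt_d9
    rw [h2]
    nlinarith

theorem eight_lt_of_le_boundB {p d n : ℕ} {lam ω : ℝ} (hlam : 0 < lam) (hpd : 1 ≤ p * d)
    (hn0 : 1 ≤ n) (h : (n : ℝ) ≤ boundB p d lam ω) : 8 < p * d := by
  by_contra! hle
  have hle' : (p : ℝ) * d ≤ 8 := by exact_mod_cast hle
  have hpd' : (1 : ℝ) ≤ (p : ℝ) * d := by exact_mod_cast hpd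
  have hn0' : (1 : ℝ) ≤ n := by exact_mod_cast hn0
  -- `Real.log` is log |·|, with value 0 at 0, so this also covers p d ≤ 4.
  have hlog : Real.log ((p : ℝ) * d / 4 - 1) ≤ 0 := by
    rw [← Real.log_abs]
    exact Real.log_nonpos (abs_nonneg _) (abs_le.2 ⟨by linarith, by linarith⟩)
  have : boundB p d lam ω ≤ 0 := by
    rw [boundB]
    refine div_nonpos_of_nonpos_of_nonneg ?_ (by positivity)
    exact mul_nonpos_of_nonneg_of_nonpos (by positivity) hlog
  linarith

/-- Here d λ ≤ ω, exp(3λ/2) ≥ 1 and 2 ω ≤ exp(3ω/4) leave exp(ω)/256 as the prefactor of the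
logarithm. -/
theorem mul_exp_neg_le_of_le_boundB {p d n : ℕ} {lam ω : ℝ} (hlam : 0 < lam)
    (hlamω : lam * d ≤ ω) (hpd : 8 < p * d) (h : (n : ℝ) ≤ boundB p d lam ω) :
    256 * (n * Real.exp (-ω)) ≤ Real.log ((p : ℝ) * d / 4 - 1) := by
  have hpd' : (8 : ℝ) < (p : ℝ) * d := by exact_mod_cast hpd
  have hlog : 0 ≤ Real.log ((p : ℝ) * d / 4 - 1) := Real.log_nonneg (by linarith)
  rw [boundB, le_div_iff₀ (by positivity)] at h
  have h1 : (1 : ℝ) ≤ Real.exp (3 * lam / 2) := Real.one_le_exp (by positivity)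
  have h2 : (n : ℝ) * 128 ≤ Real.exp (ω / 4) * ω * Real.log ((p : ℝ) * d / 4 - 1) := by
    calc (n : ℝ) * 128 ≤ n * (128 * Real.exp (3 * lam / 2)) := by
          gcongr; linarith
      _ ≤ _ := h
      _ ≤ _ := by
          gcongr ?_ * _
          rw [mul_assoc]
          gcongr
          linarith
  have h3 : Real.exp (-ω) * Real.exp (ω / 4) * Real.exp (3 / 4 * ω) = 1 := by
    rw [← Real.exp_add, ← Real.exp_add, Real.exp_eq_one_iff]; ring
  have h4 := two_mul_le_exp ω
  have h5 : Real.exp (-ω) * Real.exp (ω / 4) * (2 * ω) ≤ 1 := by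
    rw [← h3]; gcongr
  calc 256 * (n * Real.exp (-ω)) = 2 * Real.exp (-ω) * (n * 128) := by ring
    _ ≤ 2 * Real.exp (-ω) * (Real.exp (ω / 4) * ω * Real.log ((p : ℝ) * d / 4 - 1)) := by gcongr
    _ = (Real.exp (-ω) * Real.exp (ω / 4) * (2 * ω)) * Real.log ((p : ℝ) * d / 4 - 1) := by ring
    _ ≤ 1 * Real.log ((p : ℝ) * d / 4 - 1) := by gcongr
    _ = _ := one_mul _

/-- When ω = λ, exp(λ/4) λ ≤ exp(3λ/2), so the threshold is at most log p / 128. -/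
theorem mul_tanh_sq_le_of_le_boundB {p n : ℕ} {lam : ℝ} (hlam : 0 < lam) (hp : 8 < p)
    (h : (n : ℝ) ≤ boundB p 1 lam lam) : n * Real.tanh lam ^ 2 ≤ Real.log p / 2 := by
  have hp' : (8 : ℝ) < p := by exact_mod_cast hp
  have hlog : 0 ≤ Real.log ((p : ℝ) / 4 - 1) := Real.log_nonneg (by linarith)
  have hlog' : Real.log ((p : ℝ) / 4 - 1) ≤ Real.log p :=
    Real.log_le_log (by linarith) (by linarith)
  rw [boundB, le_div_iff₀ (by positivity), Nat.cast_one, mul_one, mul_one] at h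
  have h1 : Real.exp (lam / 4) * lam ≤ Real.exp (3 * lam / 2) := by
    calc Real.exp (lam / 4) * lam ≤ Real.exp (lam / 4) * Real.exp (5 / 4 * lam) := by
          gcongr
          have := Real.add_one_le_exp (5 / 4 * lam)
          linarith
      _ = _ := by rw [← Real.exp_add]; ring_nf
  have h2 : (n : ℝ) * 128 * Real.exp (3 * lam / 2) ≤
      Real.log p * Real.exp (3 * lam / 2) := by
    calc (n : ℝ) * 128 * Real.exp (3 * lam / 2) = n * (128 * Real.exp (3 * lam / 2)) := by ring
      _ ≤ _ := h
      _ ≤ Real.exp (3 * lam / 2) * Real.log p := by gcongr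
      _ = _ := mul_comm _ _
  have h3 := le_of_mul_le_mul_right h2 (Real.exp_pos _)
  have h4 := mul_le_mul_of_nonneg_left (tanh_sq_le_one lam) (Nat.cast_nonneg (α := ℝ) n)
  have h5 : (0 : ℝ) ≤ n := Nat.cast_nonneg n
  linarith

/-- The exponent 32 is 256/8, the ratio of the constants in `mul_exp_neg_le_of_le_boundB` and the
triangle bound. The base is at least 1 + (m - 1)/3, whose 16th power is at least 2m by Bernoulli. -/
theorem four_mul_sq_le_pow {m : ℕ} (hm : 2 ≤ m) :
    4 * (m : ℝ) ^ 2 ≤ ((m : ℝ) ^ 2 / (2 * m - 1)) ^ 32 := by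
  have hm' : (2 : ℝ) ≤ m := by exact_mod_cast hm
  have h1 : 1 + ((m : ℝ) - 1) / 3 ≤ (m : ℝ) ^ 2 / (2 * m - 1) := by
    rw [le_div_iff₀ (by linarith)]
    nlinarith
  have h2 := one_add_mul_le_pow (a := ((m : ℝ) - 1) / 3) (by linarith) 16
  push_cast at h2
  calc 4 * (m : ℝ) ^ 2 = (2 * m) ^ 2 := by ring
    _ ≤ ((1 + ((m : ℝ) - 1) / 3) ^ 16) ^ 2 := by gcongr; linarith
    _ ≤ (((m : ℝ) ^ 2 / (2 * m - 1)) ^ 16) ^ 2 := by gcongr; linarith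
    _ = _ := by rw [← pow_mul]

theorem knownWeightsBound_of_le_boundB {p d n : ℕ} {lam ω : ℝ} (hd : 2 ≤ d) (hdp : d < p)
    (hlam : 0 < lam) (hlamω : lam * d ≤ ω) (hn0 : 1 ≤ n)
    (hn : (n : ℝ) ≤ boundB p d lam ω) : KnownWeightsBound p d n lam ω := by
  have hpd := eight_lt_of_le_boundB hlam (Nat.mul_pos (by omega) (by omega)) hn0 hn
  have hpd' : (8 : ℝ) < (p : ℝ) * d := by exact_mod_cast hpd
  have hexp := mul_exp_neg_le_of_le_boundB hlam hlamω hpd hn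
  have hdp' : (d : ℝ) ≤ p := by exact_mod_cast hdp.le
  -- A single block would give m² / (2m - 1) = 1, which permits no samples; hence two blocks or the
  -- three paths.
  rcases le_or_gt 6 p with hp | hp
  · refine knownWeightsBound_of_triangles (by omega) hd hlam hlamω ?_
    set m := p / 3 with hm
    have hm2 : 2 ≤ m := by omega
    have hpm : (p : ℝ) ≤ 4 * m := by
      exact_mod_cast (by omega : p ≤ 4 * m)
    have hm2' : (2 : ℝ) ≤ m := by exact_mod_cast hm2
    have hR : (0 : ℝ) < (m : ℝ) ^ 2 / (2 * m - 1) := div_pos (by positivity) (by linarith)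
    have hlog : Real.log ((p : ℝ) * d / 4 - 1) ≤
        32 * Real.log ((m : ℝ) ^ 2 / (2 * m - 1)) := by
      have h1 : (p : ℝ) * d / 4 - 1 ≤ 4 * (m : ℝ) ^ 2 := by nlinarith
      have := Real.log_le_log (by linarith) (h1.trans (four_mul_sq_le_pow hm2))
      rw [Real.log_pow] at this
      exact_mod_cast this
    calc (1 + 8 * Real.exp (-ω)) ^ n ≤ Real.exp (8 * Real.exp (-ω)) ^ n := by
          gcongr
          linarith [Real.add_one_le_exp (8 * Real.exp (-ω))]
      _ = Real.exp (8 * (n * Real.exp (-ω))) := by rw [← Real.exp_nat_mul]; ring_nf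
      _ ≤ Real.exp (Real.log ((m : ℝ) ^ 2 / (2 * m - 1))) := by
          refine Real.exp_le_exp.2 ?_
          linarith
      _ = _ := Real.exp_log hR
  · refine knownWeightsBound_of_paths (by omega) hd hlam hlamω ?_
    have hp5 : (p : ℝ) ≤ 5 := by exact_mod_cast (by omega : p ≤ 5)
    have := Real.log_le_sub_one_of_pos (by linarith : 0 < (p : ℝ) * d / 4 - 1)
    nlinarith

/-- One-edge graphs do not suffice for p = 2, but there every threshold lies below 1. -/
theorem eq_zero_of_two_vertices {n : ℕ} {lam : ℝ} (hlam : 1 ≤ lam)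
    (hn : (n : ℝ) ≤ max (max (boundA 2 lam) (boundB 2 1 lam lam)) (boundC 2 1)) : n = 0 := by
  by_contra hn0
  have hn1 : 1 ≤ n := Nat.one_le_iff_ne_zero.2 hn0
  have hn1' : (1 : ℝ) ≤ n := by exact_mod_cast hn1
  rcases le_max_iff.1 hn with h | h
  · rcases le_max_iff.1 h with h | h
    · have h1 := one_sub_tanh_le lam
      have h2 := Real.quadratic_le_exp_of_nonneg (by linarith : 0 ≤ 2 * lam)
      have h3 : Real.exp (-(2 * lam)) ≤ 1 / 5 := by
        rw [Real.exp_neg, ← one_div]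
        exact one_div_le_one_div_of_le (by norm_num) (by nlinarith)
      have ht : 3 / 5 ≤ Real.tanh lam := by linarith
      have := Real.log_two_lt_d9
      rw [boundA, le_div_iff₀ (by positivity)] at h
      push_cast at h
      nlinarith [mul_le_mul hlam ht (by norm_num) (by linarith)]
    · have := eight_lt_of_le_boundB (by linarith) (by norm_num) hn1 h
      omega
  · have : boundC 2 1 ≤ 0 := mul_nonpos_of_nonneg_of_nonpos (by positivity)
      (Real.log_nonpos (by positivity) (by norm_num))
    linarith

theorem knownWeightsBound_of_le_max {p d n : ℕ} {lam ω : ℝ} (hd : 1 ≤ d) (hdp : d < p)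
    (hlam : 0 < lam) (hω : 1 ≤ ω) (hlamω : lam * d ≤ ω)
    (hn : (n : ℝ) ≤ max (max (boundA p lam) (boundB p d lam ω)) (boundC p d))
    (hdeg : 2 ≤ d ∨ ω = lam * d ∨ (3 ≤ p ∧ (n : ℝ) ≤ max (boundA p lam) (boundC p d))) :
    KnownWeightsBound p d n lam ω := by
  rcases Nat.eq_zero_or_pos n with rfl | hn0
  · exact knownWeightsBound_zero (by omega) hd hlam hlamω
  have hsingle : 3 ≤ p → n * Real.tanh lam ^ 2 ≤ Real.log p / 2 →
      KnownWeightsBound p d n lam ω := fun hp h =>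
    knownWeightsBound_of_single_edges hp hd hlam hlamω (one_add_tanh_sq_pow_le_sqrt (by omega) h)
  have hA : 3 ≤ p → (n : ℝ) ≤ boundA p lam → KnownWeightsBound p d n lam ω := fun hp h =>
    hsingle hp (mul_tanh_sq_le_of_le_boundA hlam h)
  have hC : (n : ℝ) ≤ boundC p d → KnownWeightsBound p d n lam ω :=
    knownWeightsBound_of_le_boundC hd hlam hlamω hn0
  have htwo : 2 ≤ d → KnownWeightsBound p d n lam ω := fun hd2 => by
    rcases le_max_iff.1 hn with h | h
    · rcases le_max_iff.1 h with h | h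
      · exact hA (by omega) h
      · exact knownWeightsBound_of_le_boundB hd2 hdp hlam hlamω hn0 h
    · exact hC h
  rcases hdeg with hd2 | hdeg | ⟨hp, h⟩
  · exact htwo hd2
  · rcases hd.eq_or_lt with rfl | hd2
    · rw [Nat.cast_one, mul_one] at hdeg
      subst hdeg
      rcases (by omega : p = 2 ∨ 3 ≤ p) with rfl | hp
      · exact absurd (eq_zero_of_two_vertices hω hn) (by omega)
      rcases le_max_iff.1 hn with h | h
      · rcases le_max_iff.1 h with h | h
        · exact hA hp h
        · have h8 := eight_lt_of_le_boundB hlam (by omega) hn0 h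
          exact hsingle hp (mul_tanh_sq_le_of_le_boundB hlam (by omega) h)
      · exact hC h
    · exact htwo hd2
  · rcases le_max_iff.1 h with h | h
    · exact hA hp h
    · exact hC h

end IsingSelection

theorem theorem1 (p d n : ℕ) (lam ω : ℝ)
    (hd : 1 ≤ d) (hdp : d < p)
    (hlam : 0 < lam) (hω : 1 ≤ ω) (hlamω : lam * d ≤ ω)
    (hn : (n : ℝ) ≤ max (max (IsingSelection.boundA p lam) (IsingSelection.boundB p d lam ω))
      (IsingSelection.boundC p d))
    (hdeg : 2 ≤ d ∨ ω = lam * d ∨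
      (3 ≤ p ∧ (n : ℝ) ≤ max (IsingSelection.boundA p lam) (IsingSelection.boundC p d))) :
    -- known edge weights: some assignment of weights to graphs, revealed to the decoder
    (∃ θ : IsingSelection.BoundedDegreeGraph p d → IsingSelection.Weights p,
      (∀ G, IsingSelection.Admissible lam ω G.1 (θ G)) ∧
      ∀ φ : IsingSelection.Decoder p d n, ∃ G : IsingSelection.BoundedDegreeGraph p d,
        1 / 2 ≤ IsingSelection.errorProb φ G (θ G)) ∧
    -- unknown edge weights
    (∀ φ : IsingSelection.Decoder p d n,
      ∃ (G : IsingSelection.BoundedDegreeGraph p d) (θ : IsingSelection.Weights p),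
        IsingSelection.Admissible lam ω G.1 θ ∧ 1 / 2 ≤ IsingSelection.errorProb φ G θ) := by
  obtain ⟨θ, hθ, h⟩ :=
    IsingSelection.knownWeightsBound_of_le_max hd hdp hlam hω hlamω hn hdeg
  exact ⟨⟨θ, hθ, h⟩, fun φ => (h φ).imp fun G hG => ⟨θ G, hθ G, hG⟩⟩
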